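/- Theorem (Exact two-dimensional sequence). Let $F\subset\mathbb{R}^2$ be a polygon, that is, the interior of a finite union of triangles, and assume that $F$ is simply connected, with connected and Lipschitz-continuous boundary $\partial F$ (locally, $F$ is the epigraph of a Lipschitz function). Let $\mathcal{E}_F$ be the finite set of edges of $F$: non-degenerate segments that cover $\partial F$ and meet only at common vertices. Each edge $E$ is oriented by a unit tangent vector $t_E$; $n_{FE}$ is the unit normal vector such that $(t_E,n_{FE})$ is right-handed, and $\omega_{FE}=1$ if $t_E$ points opposite to the counter-clockwise orientation of $\partial F$, $\omega_{FE}=-1$ otherwise (so that $\omega_{FE}n_{FE}$ points out of $F$). Let $k\ge 0$ be an integer. For $\ell\ge-1$, let $\mathcal{P}_\ell(X)$ be the space of polynomials of total degree $\le\ell$ on $X\in\{F\}\cup\mathcal{E}_F$, with $\mathcal{P}_{-1}(X)=\{0\}$; let $\mathcal{P}_\ell(\mathcal{E}_F)$ be the space of functions on $\partial F$ whose restriction to each $E\in\mathcal{E}_F$ is in $\mathcal{P}_\ell(E)$, identified with the families of these restrictions, and let $\mathcal{P}^c_\ell(\partial F)$ be the space of continuous functions on $\partial F$ whose restriction to each $E\in\mathcal{E}_F$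 is in $\mathcal{P}_\ell(E)$. Let $\mathbf{rot}\,r=(\partial_2 r,-\partial_1 r)$, let $\mathcal{R}_\ell(F)=\mathbf{rot}\,\mathcal{P}_{\ell+1}(F)$, and let $\mathcal{R}_\ell(F)^\perp$ be the $L^2$-orthogonal complement of $\mathcal{R}_\ell(F)$ in $\mathcal{P}_\ell(F)^2$. Then the sequence $$\mathbb{R}\xrightarrow{\ I\ }\mathcal{P}_{k-1}(F)\times\mathcal{P}^c_{k+1}(\partial F)\xrightarrow{\ G_F\ }\big(\mathcal{R}_{k-1}(F)\oplus\mathcal{R}_k(F)^\perp\big)\times\mathcal{P}_k(\mathcal{E}_F)\xrightarrow{\ C_F\ }\mathcal{P}_k(F)\xrightarrow{\ 0\ }\{0\}$$ is exact, that is, $I(\mathbb{R})=\ker G_F$, $\operatorname{Im}G_F=\ker C_F$ and $\operatorname{Im}C_F=\mathcal{P}_k(F)$. Here: - for $q$ continuous on $\overline F$, $I(q)=(q_F,q_{\partial F})$, where $q_F$ is the $L^2$-orthogonal projection of $q$ on $\mathcal{P}_{k-1}(F)$, and $q_{\partial F}$ is the unique element of $\mathcal{P}^c_{k+1}(\partial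 F)$ that coincides with $q$ at the vertices and, on each edge $E$, has the same $L^2$-orthogonal projection on $\mathcal{P}_{k-1}(E)$ as $q$; in the sequence, a real number is regarded as a constant function; - $G_F(q_F,q_{\partial F})=(\pi g+\pi^\perp g,\,G_{\partial F}q_{\partial F})$, where $G_{\partial F}q_{\partial F}$ is, on each edge $E$, the derivative of $q_{\partial F}$ in the direction $t_E$, where $\pi$ and $\pi^\perp$ are the $L^2$-orthogonal projectors on $\mathcal{R}_{k-1}(F)$ and on $\mathcal{R}_k(F)^\perp$, and where $g\in\mathcal{P}_k(F)^2$ is defined by $$\int_F g\cdot w=-\int_F q_F\,\mathrm{div}\,w+\sum_{E\in\mathcal{E}_F}\omega_{FE}\int_E q_{\partial F}\,(w\cdot n_{FE})\qquad\forall w\in\mathcal{P}_k(F)^2;$$ - $C_F(v_F,v_{\partial F})\in\mathcal{P}_k(F)$ is defined by $$\int_F C_F(v_F,v_{\partial F})\,r=\int_F v_F\cdot\mathbf{rot}\,r-\sum_{E\in\mathcal{E}_F}\omega_{FE}\int_E v_{\partial F}\,r\qquad\forall r\in\mathcal{P}_k(F).$$ -/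

import Mathlib

open MeasureTheory Filter Topology

noncomputable section

namespace DiscreteDeRham

/-! ### Riesz representatives in finite-dimensional subspaces -/

section Riesz

variable {M : Type*} [AddCommGroup M] [Module ℝ M]

theorem restrict_nondegenerate (B : LinearMap.BilinForm ℝ M) (hB : ∀ m, B m m = 0 → m = 0)
    (V : Submodule ℝ M) : (B.restrict V).Nondegenerate := by
  refine ⟨fun v hv => ?_, fun v hv => ?_⟩ <;>
  · have h := hv v
    exact Subtype.ext (hB _ h)

/-- For a bilinear form `B` with `B m m ≠ 0` for `m ≠ 0`, the element `v` of the finite-dimensional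
subspace `V` such that `B v w = φ w` for all `w ∈ V`. -/
def riesz (B : LinearMap.BilinForm ℝ M) (hB : ∀ m, B m m = 0 → m = 0)
    (V : Submodule ℝ M) [FiniteDimensional ℝ V] : Module.Dual ℝ V →ₗ[ℝ] V :=
  ((LinearMap.BilinForm.toDual (B.restrict V) (restrict_nondegenerate B hB V)).symm :
    Module.Dual ℝ V ≃ₗ[ℝ] V)

theorem riesz_spec (B : LinearMap.BilinForm ℝ M) (hB : ∀ m, B m m = 0 → m = 0)
    (V : Submodule ℝ M) [FiniteDimensional ℝ V] (φ : Module.Dual ℝ V) (w : V) :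
    B (riesz B hB V φ) w = φ w :=
  LinearMap.BilinForm.apply_toDual_symm_apply (B := B.restrict V)
    (hB := restrict_nondegenerate B hB V) φ w

end Riesz

/-! ### Polynomials and plane vector calculus -/

/-- The oriented Euclidean plane; the unit normal `n_F` to the plane of the polygon is the one for
which the standard basis is right-handed. -/
abbrev Plane := EuclideanSpace ℝ (Fin 2)

/-- Bivariate polynomials. They are identified with polynomial functions on `F`, which is legitimate
because `F` has nonempty interior. -/
abbrev Poly2 := MvPolynomial (Fin 2) ℝ

/-- Vector-valued bivariate polynomials. -/
abbrev VPoly2 := Fin 2 → Poly2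

/-- `P_ℓ(F)`: bivariate polynomials of total degree at most `ℓ`; it is `{0}` for `ℓ = -1`. -/
def Poly (ℓ : ℤ) : Submodule ℝ Poly2 where
  carrier := {p | ∀ d : Fin 2 →₀ ℕ, ℓ < (d.degree : ℤ) → p.coeff d = 0}
  add_mem' {p q} hp hq d hd := by simp [hp d hd, hq d hd]
  zero_mem' := by simp
  smul_mem' c p hp d hd := by simp [hp d hd]

/-- `P_ℓ(F)²`. -/
def VPoly (ℓ : ℤ) : Submodule ℝ VPoly2 := Submodule.pi Set.univ fun _ => Poly ℓ

/-- `P_ℓ(E)`: univariate polynomials of degree at most `ℓ` in the arclength parameter of `E`;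
it is `{0}` for `ℓ = -1`. -/
def EdgePoly (ℓ : ℤ) : Submodule ℝ (Polynomial ℝ) where
  carrier := {p | ∀ n : ℕ, ℓ < (n : ℤ) → p.coeff n = 0}
  add_mem' {p q} hp hq n hn := by simp [hp n hn, hq n hn]
  zero_mem' := by simp
  smul_mem' c p hp n hn := by simp [hp n hn]

/-- The gradient. -/
def gradient : Poly2 →ₗ[ℝ] VPoly2 :=
  LinearMap.pi fun i => (MvPolynomial.pderiv i).toLinearMap

/-- The divergence. -/
def divergence : VPoly2 →ₗ[ℝ] Poly2 :=
  ∑ i : Fin 2, (MvPolynomial.pderiv i).toLinearMap ∘ₗ LinearMap.proj i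

/-- The rotation of angle `-π/2`, i.e. `(x, y) ↦ (y, -x)`. -/
def rotateCW : VPoly2 →ₗ[ℝ] VPoly2 :=
  LinearMap.pi ![LinearMap.proj 1, -LinearMap.proj 0]

/-- The vector curl of a scalar function: the gradient rotated by `-π/2`. -/
def vrot : Poly2 →ₗ[ℝ] VPoly2 := rotateCW ∘ₗ gradient

/-- `R_ℓ(F)`, the image of `P_{ℓ+1}(F)` by the vector curl. -/
def Roly (ℓ : ℤ) : Submodule ℝ VPoly2 := (Poly (ℓ + 1)).map vrot

instance finiteDimensional_Poly (ℓ : ℤ) : FiniteDimensional ℝ (Poly ℓ) := by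
  have : Poly ℓ ≤ MvPolynomial.restrictTotalDegree (Fin 2) ℝ ℓ.toNat := by
    intro p hp
    rw [MvPolynomial.mem_restrictTotalDegree]
    refine Finset.sup_le fun d hd => ?_
    by_contra h
    refine MvPolynomial.mem_support_iff.1 hd (hp d ?_)
    have h' : ℓ.toNat < d.degree := not_le.1 h
    omega
  exact Submodule.finiteDimensional_of_le this

instance finiteDimensional_VPoly (ℓ : ℤ) : FiniteDimensional ℝ (VPoly ℓ) := by
  let f : VPoly ℓ →ₗ[ℝ] (Fin 2 → Poly ℓ) :=
    LinearMap.pi fun i =>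
      (LinearMap.proj i ∘ₗ (VPoly ℓ).subtype).codRestrict (Poly ℓ) fun v => v.2 i trivial
  refine FiniteDimensional.of_injective f fun v w h => Subtype.ext (funext fun i => ?_)
  exact congrArg Subtype.val (congrFun h i)

instance finiteDimensional_Roly (ℓ : ℤ) : FiniteDimensional ℝ (Roly ℓ) := by
  unfold Roly; infer_instance

instance finiteDimensional_EdgePoly (ℓ : ℤ) : FiniteDimensional ℝ (EdgePoly ℓ) := by
  have : EdgePoly ℓ ≤ Polynomial.degreeLT ℝ (ℓ.toNat + 1) := by
    intro p hp
    rw [Polynomial.mem_degreeLT, Polynomial.degree_lt_iff_coeff_zero]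
    intro m hm
    exact hp m (by omega)
  exact Submodule.finiteDimensional_of_le this

/-! ### Polygons -/

/-- The boundary of `Ω` is Lipschitz: near each of its points, `Ω` is, in suitable orthonormal
coordinates, the strict epigraph of a Lipschitz function. -/
def HasLipschitzBoundary (Ω : Set Plane) : Prop :=
  ∀ x ∈ frontier Ω, ∃ r > 0, ∃ e₁ e₂ : Plane, ‖e₁‖ = 1 ∧ ‖e₂‖ = 1 ∧ inner ℝ e₁ e₂ = 0 ∧
    ∃ (K : NNReal) (φ : ℝ → ℝ), LipschitzWith K φ ∧
      ∀ y ∈ Metric.ball x r, y ∈ Ω ↔ φ (inner ℝ e₁ y) < inner ℝ e₂ y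

/-- `Ω` is a (simply connected, Lipschitz) polygon: it is the interior of a finite union of
(non-degenerate, closed) triangles, it is simply connected (in particular it is nonempty and
connected), and its boundary is connected and Lipschitz. -/
structure IsPolygon (Ω : Set Plane) : Prop where
  exists_triangles : ∃ S : Finset (Affine.Simplex ℝ Plane 2),
    Ω = interior (⋃ T ∈ S, convexHull ℝ (Set.range T.points))
  isSimplyConnected : IsSimplyConnected Ω
  isConnected_frontier : IsConnected (frontier Ω)
  hasLipschitzBoundary : HasLipschitzBoundary Ω

/-- A polygon with its edges. An edge `E` is given by its vertices `(x_{E,1}, x_{E,2})`, whose order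
prescribes the (arbitrary) orientation `t_E` of `E`. The edges are non-degenerate segments that
cover the boundary and that meet only at common vertices. Two consecutive edges may be aligned. -/
structure OrientedPolygon where
  /-- The polygon itself, an open set. -/
  carrier : Set Plane
  isPolygon : IsPolygon carrier
  /-- The set of edges. -/
  edges : Finset (Plane × Plane)
  fst_ne_snd : ∀ E ∈ edges, E.1 ≠ E.2
  iUnion_segment : ⋃ E ∈ edges, segment ℝ E.1 E.2 = frontier carrier
  segment_inter_subset : ∀ E ∈ edges, ∀ E' ∈ edges, E ≠ E' →
    segment ℝ E.1 E.2 ∩ segment ℝ E'.1 E'.2 ⊆ {E.1, E.2} ∩ {E'.1, E'.2}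

/-! ### Geometry of an edge -/

/-- The length `|E|`. -/
def edgeLength (E : Plane × Plane) : ℝ := dist E.1 E.2

/-- The unit tangent vector `t_E`. -/
def tangent (E : Plane × Plane) : Plane := (edgeLength E)⁻¹ • (E.2 - E.1)

/-- The unit normal vector `n_{FE}`, such that `(t_E, n_{FE})` is right-handed. -/
def normal (E : Plane × Plane) : Plane := !₂[-(tangent E 1), tangent E 0]

/-- The arclength parametrisation `s ↦ x_{E,1} + s t_E`, for `0 ≤ s ≤ |E|`. -/
def edgePoint (E : Plane × Plane) (s : ℝ) : Plane := E.1 + s • tangent E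

/-- `∫_E p`, for a polynomial `p` in the arclength parameter of `E`. -/
def edgeInt (E : Plane × Plane) : Polynomial ℝ →ₗ[ℝ] ℝ where
  toFun p := ∫ s in (0 : ℝ)..edgeLength E, p.eval s
  map_add' p q := by
    simp only [Polynomial.eval_add]
    exact intervalIntegral.integral_add (p.continuous.intervalIntegrable _ _)
      (q.continuous.intervalIntegrable _ _)
  map_smul' c p := by simp

/-- The product `∫_E s (|E| - s) p q`, used to show that the interpolator is well-defined. -/
def bubbleForm (E : Plane × Plane) : LinearMap.BilinForm ℝ (Polynomial ℝ) :=
  (LinearMap.mul ℝ (Polynomial ℝ)).compr₂ (edgeInt E ∘ₗ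
    LinearMap.mulLeft ℝ (Polynomial.X * (Polynomial.C (edgeLength E) - Polynomial.X)))

theorem bubbleForm_definite {E : Plane × Plane} (hE : 0 < edgeLength E) (p : Polynomial ℝ)
    (hp : bubbleForm E p p = 0) : p = 0 := by
  set g : ℝ → ℝ := fun s => s * (edgeLength E - s) * (p.eval s * p.eval s) with hg
  have hgc : Continuous g := by fun_prop
  have h0 : ∫ s in (0 : ℝ)..edgeLength E, g s = 0 := by
    have : bubbleForm E p p = ∫ s in (0 : ℝ)..edgeLength E, g s := by
      simp [bubbleForm, edgeInt, hg, mul_assoc]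
    rw [← this, hp]
  refine Polynomial.eq_zero_of_infinite_isRoot p ((Set.Ioo_infinite hE).mono fun s hs => ?_)
  by_contra hne
  refine absurd h0 (ne_of_gt (intervalIntegral.integral_pos hE hgc.continuousOn ?_ ?_))
  · intro x hx
    exact mul_nonneg (mul_nonneg hx.1.le (by linarith [hx.2])) (mul_self_nonneg _)
  · exact ⟨s, ⟨hs.1.le, hs.2.le⟩,
      mul_pos (mul_pos hs.1 (by linarith [hs.2])) (mul_self_pos.2 hne)⟩

theorem bubble_mul_mem (E : Plane × Plane) (k : ℕ) (p : Polynomial ℝ)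
    (hp : p ∈ EdgePoly ((k : ℤ) - 1)) :
    Polynomial.X * (Polynomial.C (edgeLength E) - Polynomial.X) * p ∈ EdgePoly ((k : ℤ) + 1) := by
  intro n hn
  obtain ⟨m, rfl⟩ : ∃ m, n = m + 2 := ⟨n - 2, by omega⟩
  have e : Polynomial.X * (Polynomial.C (edgeLength E) - Polynomial.X) * p =
      Polynomial.C (edgeLength E) * (p * Polynomial.X) - p * Polynomial.X ^ 2 := by ring
  rw [e, Polynomial.coeff_sub, Polynomial.coeff_mul_X_pow, Polynomial.coeff_C_mul,
    Polynomial.coeff_mul_X, hp m (by push_cast at hn; omega),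
    hp (m + 1) (by push_cast at hn ⊢; omega)]
  simp

theorem edge_unique {E : Plane × Plane} (hE : 0 < edgeLength E) (k : ℕ) (d : Polynomial ℝ)
    (hd : d ∈ EdgePoly ((k : ℤ) + 1)) (h0 : d.eval 0 = 0) (hL : d.eval (edgeLength E) = 0)
    (h : ∀ r ∈ EdgePoly ((k : ℤ) - 1), edgeInt E (d * r) = 0) : d = 0 := by
  obtain ⟨a, rfl⟩ := Polynomial.X_dvd_iff.2 ((Polynomial.coeff_zero_eq_eval_zero d).trans h0)
  have ha : a.eval (edgeLength E) = 0 := by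
    rw [Polynomial.eval_mul, Polynomial.eval_X] at hL
    exact (mul_eq_zero.1 hL).resolve_left hE.ne'
  obtain ⟨b, rfl⟩ := Polynomial.dvd_iff_isRoot.2 ha
  suffices hb : b = 0 by simp [hb]
  have hmem : b ∈ EdgePoly ((k : ℤ) - 1) := by
    intro n hn
    by_contra hne
    have hb0 : b ≠ 0 := fun h => hne (by simp [h])
    have hdeg : n ≤ b.natDegree := Polynomial.le_natDegree_of_ne_zero hne
    have hprod : Polynomial.X * ((Polynomial.X - Polynomial.C (edgeLength E)) * b) ≠ 0 :=
      mul_ne_zero Polynomial.X_ne_zero (mul_ne_zero (Polynomial.X_sub_C_ne_zero _) hb0)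
    have hnd : (Polynomial.X * ((Polynomial.X - Polynomial.C (edgeLength E)) * b)).natDegree =
        b.natDegree + 2 := by
      rw [Polynomial.natDegree_mul Polynomial.X_ne_zero
          (mul_ne_zero (Polynomial.X_sub_C_ne_zero _) hb0),
        Polynomial.natDegree_mul (Polynomial.X_sub_C_ne_zero _) hb0, Polynomial.natDegree_X,
        Polynomial.natDegree_X_sub_C]
      ring
    refine hprod (Polynomial.leadingCoeff_eq_zero.1 ?_)
    rw [Polynomial.leadingCoeff, hnd]
    exact hd _ (by push_cast; omega)
  refine bubbleForm_definite hE b ?_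
  have h1 := h b hmem
  have e : Polynomial.X * ((Polynomial.X - Polynomial.C (edgeLength E)) * b) * b =
      -(Polynomial.X * (Polynomial.C (edgeLength E) - Polynomial.X) * (b * b)) := by ring
  rw [e, map_neg, neg_eq_zero] at h1
  exact h1

theorem edge_exists {E : Plane × Plane} (hE : 0 < edgeLength E) (k : ℕ) (f : ℝ → ℝ)
    (hf : ContinuousOn f (Set.Icc 0 (edgeLength E))) :
    ∃ p ∈ EdgePoly ((k : ℤ) + 1), p.eval 0 = f 0 ∧ p.eval (edgeLength E) = f (edgeLength E) ∧
      ∀ r ∈ EdgePoly ((k : ℤ) - 1),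
        ∫ s in (0 : ℝ)..edgeLength E, (p.eval s - f s) * r.eval s = 0 := by
  set L := edgeLength E with hLdef
  have hf' : ContinuousOn f (Set.uIcc 0 L) := by rwa [Set.uIcc_of_le hE.le]
  set l : Polynomial ℝ :=
    Polynomial.C (f 0) + Polynomial.C ((f L - f 0) / L) * Polynomial.X with hl
  have hint : ∀ r : Polynomial ℝ,
      IntervalIntegrable (fun s => (f s - l.eval s) * r.eval s) volume 0 L := fun r =>
    ((hf'.sub l.continuous.continuousOn).mul r.continuous.continuousOn).intervalIntegrable
  let φ : Module.Dual ℝ (EdgePoly ((k : ℤ) - 1)) :=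
    { toFun := fun r => ∫ s in (0 : ℝ)..L, (f s - l.eval s) * (r : Polynomial ℝ).eval s
      map_add' := fun r r' => by
        simp only [Submodule.coe_add, Polynomial.eval_add, mul_add]
        exact intervalIntegral.integral_add (hint r) (hint r')
      map_smul' := fun c r => by
        simp [mul_left_comm _ c] }
  let r₁ := riesz (bubbleForm E) (bubbleForm_definite hE) (EdgePoly ((k : ℤ) - 1)) φ
  let r₀ : Polynomial ℝ := r₁
  refine ⟨l + Polynomial.X * (Polynomial.C L - Polynomial.X) * r₀,
    add_mem ?_ (bubble_mul_mem E k _ r₁.2), ?_, ?_, fun r hr => ?_⟩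
  · intro n hn
    obtain ⟨m, rfl⟩ : ∃ m, n = m + 2 := ⟨n - 2, by omega⟩
    rw [hl, Polynomial.coeff_add, Polynomial.coeff_C_mul, Polynomial.coeff_X,
      Polynomial.coeff_C]
    simp
  · simp [hl]
  · simp only [hl, Polynomial.eval_add, Polynomial.eval_mul, Polynomial.eval_C, Polynomial.eval_X,
      Polynomial.eval_sub, sub_self, mul_zero, zero_mul, add_zero]
    field_simp
    ring
  · have h := riesz_spec (bubbleForm E) (bubbleForm_definite hE) (EdgePoly ((k : ℤ) - 1)) φ ⟨r, hr⟩
    have h1 : bubbleForm E r₀ r = ∫ s in (0 : ℝ)..L,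
        (Polynomial.X * (Polynomial.C L - Polynomial.X) * (r₀ * r) : Polynomial ℝ).eval s := rfl
    have h2 : φ ⟨r, hr⟩ = ∫ s in (0 : ℝ)..L, (f s - l.eval s) * r.eval s := rfl
    change bubbleForm E r₀ r = φ ⟨r, hr⟩ at h
    rw [h1, h2, ← sub_eq_zero, ← intervalIntegral.integral_sub
      ((Polynomial.continuous _).intervalIntegrable _ _) (hint r)] at h
    rw [← h]
    congr 1
    funext s
    simp only [Polynomial.eval_add, Polynomial.eval_mul]
    ring

/-- The restriction to `E` of a bivariate polynomial, in the arclength parameter of `E`. -/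
def edgeTrace (E : Plane × Plane) : Poly2 →ₐ[ℝ] Polynomial ℝ :=
  MvPolynomial.aeval fun i => Polynomial.C (E.1 i) + Polynomial.C (tangent E i) * Polynomial.X

theorem eval_edgeTrace (E : Plane × Plane) (p : Poly2) (s : ℝ) :
    (edgeTrace E p).eval s = MvPolynomial.eval (fun i => edgePoint E s i) p := by
  induction p using MvPolynomial.induction_on with
  | C a => simp [edgeTrace]
  | add p q hp hq => simp [hp, hq]
  | mul_X p i hp => simp [hp]; left; simp [edgeTrace, edgePoint]; ring

/-- `(w · n_{FE})` on `E`, for a vector-valued polynomial `w`. -/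
def normalTrace (E : Plane × Plane) : VPoly2 →ₗ[ℝ] Polynomial ℝ :=
  ∑ i : Fin 2, normal E i • ((edgeTrace E).toLinearMap ∘ₗ LinearMap.proj i)

namespace OrientedPolygon

variable (F : OrientedPolygon)

open Classical in
/-- `ω_{FE}`. The boundary of `F` being oriented counter-clockwise means that `F` lies on its left,
and `n_{FE}` points to the left of `t_E`. So `t_E` agrees with the orientation of the boundary
(`ω_{FE} = -1`) if `F` lies on the side of `E` to which `n_{FE}` points, and is opposite to it
(`ω_{FE} = 1`) otherwise. -/
def omega (E : Plane × Plane) : ℝ :=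
  if ∀ᶠ ε : ℝ in 𝓝[>] 0, midpoint ℝ E.1 E.2 + ε • normal E ∈ F.carrier then -1 else 1

/-! ### The `L²` products on `F` and on an edge -/

theorem isOpen_carrier : IsOpen F.carrier := by
  obtain ⟨S, hS⟩ := F.isPolygon.exists_triangles
  rw [hS]; exact isOpen_interior

theorem carrier_nonempty : F.carrier.Nonempty :=
  F.isPolygon.isSimplyConnected.nonempty

theorem isBounded_carrier : Bornology.IsBounded F.carrier := by
  obtain ⟨S, hS⟩ := F.isPolygon.exists_triangles
  rw [hS]
  refine Bornology.IsBounded.subset ?_ interior_subset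
  refine (Bornology.isBounded_biUnion_finset S).2 fun T _ => ?_
  exact isBounded_convexHull.2 (Set.finite_range _).isBounded

theorem isCompact_closure : IsCompact (closure F.carrier) :=
  F.isBounded_carrier.isCompact_closure

theorem integrableOn_of_continuousOn {f : Plane → ℝ} (hf : ContinuousOn f (closure F.carrier)) :
    IntegrableOn f F.carrier :=
  (hf.integrableOn_compact F.isCompact_closure).mono_set subset_closure

theorem continuous_eval_poly (p : Poly2) :
    Continuous fun x : Plane => MvPolynomial.eval (fun i => x i) p :=
  (MvPolynomial.continuous_eval p).comp (by fun_prop)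

/-- `∫_F p`. -/
def faceInt : Poly2 →ₗ[ℝ] ℝ where
  toFun p := ∫ x in F.carrier, MvPolynomial.eval (fun i => x i) p
  map_add' p q := by
    simp only [map_add]
    exact integral_add (F.integrableOn_of_continuousOn (continuous_eval_poly p).continuousOn)
      (F.integrableOn_of_continuousOn (continuous_eval_poly q).continuousOn)
  map_smul' c p := by
    simp [MvPolynomial.smul_eval, integral_const_mul]

/-- The `L²(F)` product of scalar polynomials. -/
def l2 : LinearMap.BilinForm ℝ Poly2 := (LinearMap.mul ℝ Poly2).compr₂ F.faceInt

/-- The `L²(F)²` product of vector-valued polynomials. -/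
def vl2 : LinearMap.BilinForm ℝ VPoly2 :=
  ∑ i : Fin 2, F.l2.compl₁₂ (LinearMap.proj i) (LinearMap.proj i)

theorem l2_definite (p : Poly2) (hp : F.l2 p p = 0) : p = 0 := by
  have hc := continuous_eval_poly p
  have h0 : ∫ x in F.carrier, MvPolynomial.eval (fun i => x i) (p * p) = 0 := hp
  have hae := (setIntegral_eq_zero_iff_of_nonneg_ae
    (Eventually.of_forall fun x => by simpa using mul_self_nonneg _)
    (F.integrableOn_of_continuousOn (continuous_eval_poly (p * p)).continuousOn)).1 h0
  have heq : Set.EqOn (fun x : Plane => MvPolynomial.eval (fun i => x i) (p * p)) 0 F.carrier :=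
    Measure.eqOn_open_of_ae_eq hae F.isOpen_carrier (continuous_eval_poly _).continuousOn
      continuousOn_const
  obtain ⟨x₀, hx₀⟩ := F.carrier_nonempty
  have hopen : IsOpen ((WithLp.toLp 2 : (Fin 2 → ℝ) → Plane) ⁻¹' F.carrier) :=
    F.isOpen_carrier.preimage (PiLp.continuous_toLp 2 _)
  obtain ⟨r, hr, hball⟩ := Metric.isOpen_iff.1 hopen (WithLp.ofLp x₀) hx₀
  rw [ball_pi _ hr] at hball
  refine MvPolynomial.funext_set (fun i => Metric.ball (x₀ i) r) (fun i => ?_) fun y hy => ?_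
  · rw [Real.ball_eq_Ioo]
    exact Set.Ioo_infinite (by linarith)
  · have := heq (hball hy)
    simpa using this

theorem vl2_definite (v : VPoly2) (hv : F.vl2 v v = 0) : v = 0 := by
  have hnn : ∀ p : Poly2, 0 ≤ F.l2 p p := fun p =>
    integral_nonneg fun x => by simpa using mul_self_nonneg _
  have h : F.l2 (v 0) (v 0) + F.l2 (v 1) (v 1) = 0 := by
    simpa [vl2, Fin.sum_univ_two] using hv
  have h0 := hnn (v 0)
  have h1 := hnn (v 1)
  funext i
  fin_cases i
  · exact F.l2_definite (v 0) (by linarith)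
  · exact F.l2_definite (v 1) (by linarith)

/-- `R_ℓ(F)^⊥`, the `L²`-orthogonal complement of `R_ℓ(F)` in `P_ℓ(F)²`. -/
def RolyPerp (ℓ : ℤ) : Submodule ℝ VPoly2 :=
  VPoly ℓ ⊓ F.vl2.orthogonal (Roly ℓ)

instance finiteDimensional_RolyPerp (ℓ : ℤ) : FiniteDimensional ℝ (F.RolyPerp ℓ) :=
  Submodule.finiteDimensional_of_le inf_le_left

/-- The sum of `R_{ℓ-1}(F)` and `R_ℓ(F)^⊥` is direct. -/
theorem disjoint_Roly_RolyPerp (ℓ : ℤ) : Disjoint (Roly (ℓ - 1)) (F.RolyPerp ℓ) := by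
  refine Submodule.disjoint_def.2 fun v hv hv' => F.vl2_definite v (hv'.2 v ?_)
  have h : Poly (ℓ - 1 + 1) ≤ Poly (ℓ + 1) := fun p hp d hd => hp d (by omega)
  exact Submodule.map_mono h hv

/-- The `L²`-orthogonal projector of vector-valued polynomials onto a subspace `V`. -/
def vproj (V : Submodule ℝ VPoly2) [FiniteDimensional ℝ V] : VPoly2 →ₗ[ℝ] V :=
  riesz F.vl2 F.vl2_definite V ∘ₗ Module.Dual.transpose V.subtype ∘ₗ F.vl2

/-! ### The spaces of boundary functions -/

/-- `P_ℓ(E_F)`: functions on the boundary that are polynomial of degree at most `ℓ` on each edge,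
identified with the families of their restrictions to the edges. -/
abbrev BdryPoly (ℓ : ℤ) := F.edges → EdgePoly ℓ

/-- `p` is the restriction of `q` to the edge `E`, in the arclength parameter. -/
def IsEdgeRestriction (E : Plane × Plane) (q : C(frontier F.carrier, ℝ)) (p : Polynomial ℝ) :
    Prop :=
  ∀ (x : frontier F.carrier) (s : ℝ), s ∈ Set.Icc 0 (edgeLength E) → x = edgePoint E s →
    q x = p.eval s

/-- `P_ℓ^c(∂F)`: continuous functions on the boundary that are polynomial of degree at most `ℓ` on
each edge. -/
def BdryPolyC (ℓ : ℤ) : Submodule ℝ C(frontier F.carrier, ℝ) where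
  carrier := {q | ∀ E ∈ F.edges, ∃ p ∈ EdgePoly ℓ, F.IsEdgeRestriction E q p}
  add_mem' {q q'} hq hq' E hE := by
    obtain ⟨p, hp, h⟩ := hq E hE
    obtain ⟨p', hp', h'⟩ := hq' E hE
    exact ⟨p + p', add_mem hp hp', fun x s hs hx => by simp [h x s hs hx, h' x s hs hx]⟩
  zero_mem' E _ := ⟨0, zero_mem _, fun x s _ _ => by simp⟩
  smul_mem' c q hq E hE := by
    obtain ⟨p, hp, h⟩ := hq E hE
    exact ⟨c • p, Submodule.smul_mem _ c hp, fun x s hs hx => by simp [h x s hs hx]⟩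

theorem edgeLength_pos {E : Plane × Plane} (hE : E ∈ F.edges) : 0 < edgeLength E :=
  dist_pos.2 (F.fst_ne_snd E hE)

theorem mem_segment_iff {E : Plane × Plane} (hE : E ∈ F.edges) (x : Plane) :
    x ∈ segment ℝ E.1 E.2 ↔ ∃ s ∈ Set.Icc 0 (edgeLength E), x = edgePoint E s := by
  have hL := F.edgeLength_pos hE
  rw [segment_eq_image']
  constructor
  · rintro ⟨t, ht, rfl⟩
    refine ⟨t * edgeLength E, ⟨mul_nonneg ht.1 hL.le, mul_le_of_le_one_left hL.le ht.2⟩, ?_⟩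
    simp only [edgePoint, tangent, smul_smul, mul_assoc, mul_inv_cancel₀ hL.ne', mul_one]
  · rintro ⟨s, hs, rfl⟩
    refine ⟨s / edgeLength E, ⟨div_nonneg hs.1 hL.le, (div_le_one hL).2 hs.2⟩, ?_⟩
    simp only [edgePoint, tangent, smul_smul, div_eq_mul_inv]

theorem edgePoint_mem_frontier {E : Plane × Plane} (hE : E ∈ F.edges) {s : ℝ}
    (hs : s ∈ Set.Icc 0 (edgeLength E)) : edgePoint E s ∈ frontier F.carrier := by
  rw [← F.iUnion_segment]
  exact Set.mem_biUnion hE ((F.mem_segment_iff hE _).2 ⟨s, hs, rfl⟩)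

theorem IsEdgeRestriction.unique {E : Plane × Plane} (hE : E ∈ F.edges)
    {q : C(frontier F.carrier, ℝ)} {p p' : Polynomial ℝ} (h : F.IsEdgeRestriction E q p)
    (h' : F.IsEdgeRestriction E q p') : p = p' := by
  refine Polynomial.eq_of_infinite_eval_eq p p'
    ((Set.Icc_infinite (F.edgeLength_pos hE)).mono fun s hs => ?_)
  have hx := F.edgePoint_mem_frontier hE hs
  exact (h ⟨_, hx⟩ s hs rfl).symm.trans (h' ⟨_, hx⟩ s hs rfl)

/-- The restriction map from `P_ℓ^c(∂F)` to `P_ℓ(E_F)`. -/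
def restrictEdges (ℓ : ℤ) : F.BdryPolyC ℓ →ₗ[ℝ] F.BdryPoly ℓ where
  toFun q E := ⟨(q.2 E E.2).choose, (q.2 E E.2).choose_spec.1⟩
  map_add' q q' := by
    funext E
    refine Subtype.ext (IsEdgeRestriction.unique F E.2 ((q + q').2 E E.2).choose_spec.2 ?_)
    intro x s hs hx
    have h := (q.2 E E.2).choose_spec.2 x s hs hx
    have h' := (q'.2 E E.2).choose_spec.2 x s hs hx
    simp [h, h']
  map_smul' c q := by
    funext E
    refine Subtype.ext (IsEdgeRestriction.unique F E.2 ((c • q).2 E E.2).choose_spec.2 ?_)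
    intro x s hs hx
    have h := (q.2 E E.2).choose_spec.2 x s hs hx
    simp [h]

theorem restrictEdges_spec (ℓ : ℤ) (q : F.BdryPolyC ℓ) (E : F.edges) :
    F.IsEdgeRestriction E q (F.restrictEdges ℓ q E) :=
  (q.2 E E.2).choose_spec.2

/-! ### The discrete spaces -/

/-- The discrete `H¹` space `P_{k-1}(F) × P_{k+1}^c(∂F)`. -/
abbrev XGrad (k : ℕ) := Poly ((k : ℤ) - 1) × F.BdryPolyC ((k : ℤ) + 1)

/-- The discrete `H(rot)` space `(R_{k-1}(F) ⊕ R_k(F)^⊥) × P_k(E_F)`; the sum is direct. -/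
abbrev XRot (k : ℕ) :=
  (Roly ((k : ℤ) - 1) ⊔ F.RolyPerp (k : ℤ) : Submodule ℝ VPoly2) × F.BdryPoly (k : ℤ)

/-! ### The interpolator -/

/-- `(q_F, q_{∂F})` is the interpolate of `q`: `q_F` is the `L²`-orthogonal projection of `q` on
`P_{k-1}(F)`, `q_{∂F}` and `q` have the same `L²`-orthogonal projection on `P_{k-1}(E)` for each
edge `E`, and `q_{∂F}` and `q` coincide at the vertices. -/
structure IsInterpolate (k : ℕ) (q : Plane → ℝ) (qF : F.XGrad k) : Prop where
  face : ∀ r ∈ Poly ((k : ℤ) - 1),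
    ∫ x in F.carrier, (MvPolynomial.eval (fun i => x i) (qF.1 : Poly2) - q x) *
      MvPolynomial.eval (fun i => x i) r = 0
  edge : ∀ E : F.edges, ∀ r ∈ EdgePoly ((k : ℤ) - 1),
    ∫ s in (0 : ℝ)..edgeLength E,
      ((F.restrictEdges _ qF.2 E : Polynomial ℝ).eval s - q (edgePoint E s)) * r.eval s = 0
  vertex : ∀ E ∈ F.edges, ∀ x : frontier F.carrier, (x : Plane) = E.1 ∨ (x : Plane) = E.2 →
    (qF.2 : C(frontier F.carrier, ℝ)) x = q x

/-- Polynomials on the edges that match at the vertices are the restrictions of a continuous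
function on the boundary. -/
theorem exists_glue (ℓ : ℤ) (q : Plane → ℝ) (p : F.BdryPoly ℓ)
    (h0 : ∀ E, (p E : Polynomial ℝ).eval 0 = q (E : Plane × Plane).1)
    (hL : ∀ E, (p E : Polynomial ℝ).eval (edgeLength E) = q (E : Plane × Plane).2) :
    ∃ g : F.BdryPolyC ℓ, ∀ E : F.edges, F.IsEdgeRestriction E g (p E) := by
  have hcover : ∀ x : frontier F.carrier, ∃ E : F.edges,
      (x : Plane) ∈ segment ℝ (E : Plane × Plane).1 (E : Plane × Plane).2 := by
    intro x
    have hx : (x : Plane) ∈ ⋃ E ∈ F.edges, segment ℝ E.1 E.2 := by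
      rw [F.iUnion_segment]; exact x.2
    obtain ⟨E, hE, h⟩ := Set.mem_iUnion₂.1 hx
    exact ⟨⟨E, hE⟩, h⟩
  choose e he using hcover
  let v : F.edges → Plane → ℝ := fun E x => (p E : Polynomial ℝ).eval (dist (E : Plane × Plane).1 x)
  have hv0 : ∀ E : F.edges, v E (E : Plane × Plane).1 = q (E : Plane × Plane).1 := fun E => by
    simp [v, h0]
  have hvL : ∀ E : F.edges, v E (E : Plane × Plane).2 = q (E : Plane × Plane).2 := fun E => hL E
  have hvert : ∀ (E : F.edges) (x : Plane),
      x ∈ ({(E : Plane × Plane).1, (E : Plane × Plane).2} : Set Plane) → v E x = q x := by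
    rintro E x (rfl | rfl)
    · exact hv0 E
    · exact hvL E
  let g : frontier F.carrier → ℝ := fun x => v (e x) x
  have hg : ∀ (E : F.edges) (x : frontier F.carrier),
      (x : Plane) ∈ segment ℝ (E : Plane × Plane).1 (E : Plane × Plane).2 → g x = v E x := by
    intro E x hx
    by_cases hE : e x = E
    · simp only [g, hE]
    · have hmem := F.segment_inter_subset _ (e x).2 _ E.2 (fun h => hE (Subtype.ext h))
        ⟨he x, hx⟩
      exact (hvert _ _ hmem.1).trans (hvert _ _ hmem.2).symm
  have hgc : Continuous g := by
    let S : F.edges → Set (frontier F.carrier) := fun E =>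
      {x | (x : Plane) ∈ segment ℝ (E : Plane × Plane).1 (E : Plane × Plane).2}
    refine (locallyFinite_of_finite S).continuous (Set.eq_univ_of_forall fun x =>
      Set.mem_iUnion.2 ⟨e x, he x⟩) (fun E => ?_) (fun E => ?_)
    · have hc : IsClosed (segment ℝ (E : Plane × Plane).1 (E : Plane × Plane).2) := by
        rw [segment_eq_image_lineMap]
        exact (isCompact_Icc.image (AffineMap.lineMap_continuous)).isClosed
      exact hc.preimage continuous_subtype_val
    · have hvc : Continuous fun x : frontier F.carrier => v E x := by
        simp only [v]; fun_prop
      exact hvc.continuousOn.congr fun x hx => hg E x hx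
  have hres : ∀ E : F.edges, F.IsEdgeRestriction E ⟨g, hgc⟩ (p E) := by
    intro E x s hs hx
    have hL' := F.edgeLength_pos E.2
    change g x = _
    rw [hg E x ((F.mem_segment_iff E.2 _).2 ⟨s, hs, hx⟩)]
    have hd : dist (E : Plane × Plane).1 (x : Plane) = s := by
      rw [hx, edgePoint, dist_self_add_right, tangent, norm_smul, norm_smul, norm_inv,
        ← dist_eq_norm, dist_comm]
      change ‖s‖ * (‖edgeLength E‖⁻¹ * edgeLength E) = s
      rw [Real.norm_of_nonneg hs.1, Real.norm_of_nonneg hL'.le, inv_mul_cancel₀ hL'.ne', mul_one]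
    simp only [v, hd]
  exact ⟨⟨⟨g, hgc⟩, fun E hE => ⟨p ⟨E, hE⟩, (p ⟨E, hE⟩).2, hres ⟨E, hE⟩⟩⟩, hres⟩

theorem edgePoint_zero (E : Plane × Plane) : edgePoint E 0 = E.1 := by simp [edgePoint]

theorem edgePoint_edgeLength {E : Plane × Plane} (hE : E ∈ F.edges) :
    edgePoint E (edgeLength E) = E.2 := by
  simp [edgePoint, tangent, smul_smul, mul_inv_cancel₀ (F.edgeLength_pos hE).ne']

theorem eval_restrictEdges (ℓ : ℤ) (q : F.BdryPolyC ℓ) (E : F.edges) {s : ℝ}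
    (hs : s ∈ Set.Icc 0 (edgeLength E)) :
    (F.restrictEdges ℓ q E : Polynomial ℝ).eval s =
      (q : C(frontier F.carrier, ℝ)) ⟨edgePoint E s, F.edgePoint_mem_frontier E.2 hs⟩ :=
  (F.restrictEdges_spec ℓ q E _ s hs rfl).symm

theorem existsUnique_interpolate (k : ℕ) (q : Plane → ℝ)
    (hq : ContinuousOn q (closure F.carrier)) : ∃! qF : F.XGrad k, F.IsInterpolate k q qF := by
  have hfr : ∀ E : F.edges, ContinuousOn (fun s => q (edgePoint E s))
      (Set.Icc 0 (edgeLength E)) := fun E =>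
    hq.comp (by unfold edgePoint; fun_prop) fun s hs =>
      frontier_subset_closure (F.edgePoint_mem_frontier E.2 hs)
  refine existsUnique_of_exists_of_unique ?_ ?_
  · have hint : ∀ r : Poly2, IntegrableOn
        (fun x : Plane => q x * MvPolynomial.eval (fun i => x i) r) F.carrier := fun r =>
      F.integrableOn_of_continuousOn (hq.mul (continuous_eval_poly r).continuousOn)
    let φ : Module.Dual ℝ (Poly ((k : ℤ) - 1)) :=
      { toFun := fun r => ∫ x in F.carrier, q x * MvPolynomial.eval (fun i => x i) (r : Poly2)
        map_add' := fun r r' => by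
          simp only [Submodule.coe_add, map_add, mul_add]
          exact integral_add (hint r) (hint r')
        map_smul' := fun c r => by
          simp [MvPolynomial.smul_eval, mul_left_comm _ c, integral_const_mul] }
    let pF := riesz F.l2 F.l2_definite (Poly ((k : ℤ) - 1)) φ
    choose p hp hp0 hpL hpm using fun E : F.edges =>
      edge_exists (F.edgeLength_pos E.2) k _ (hfr E)
    obtain ⟨g, hg⟩ := F.exists_glue ((k : ℤ) + 1) q (fun E => ⟨p E, hp E⟩)
      (fun E => by rw [hp0 E, edgePoint_zero])
      (fun E => by rw [hpL E, F.edgePoint_edgeLength E.2])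
    have hrg : ∀ E : F.edges, (F.restrictEdges _ g E : Polynomial ℝ) = p E := fun E =>
      IsEdgeRestriction.unique F E.2 (F.restrictEdges_spec _ g E) (hg E)
    refine ⟨(pF, g), ?_, ?_, ?_⟩
    · intro r hr
      have h := riesz_spec F.l2 F.l2_definite (Poly ((k : ℤ) - 1)) φ ⟨r, hr⟩
      have h1 : F.l2 pF r = ∫ x in F.carrier,
        MvPolynomial.eval (fun i => x i) ((pF : Poly2) * r) := rfl
      have h2 : φ ⟨r, hr⟩ = ∫ x in F.carrier, q x * MvPolynomial.eval (fun i => x i) r := rfl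
      change F.l2 pF r = φ ⟨r, hr⟩ at h
      rw [h1, h2, ← sub_eq_zero, ← integral_sub
        (F.integrableOn_of_continuousOn (continuous_eval_poly _).continuousOn) (hint r)] at h
      rw [← h]
      congr 1
      funext x
      simp only [map_mul]
      ring
    · intro E r hr
      rw [hrg E]
      exact hpm E r hr
    · rintro E hE x (hx | hx)
      · rw [hg ⟨E, hE⟩ x 0 ⟨le_rfl, (F.edgeLength_pos hE).le⟩ (by rw [hx, edgePoint_zero]), hx]
        exact (hp0 ⟨E, hE⟩).trans (by rw [edgePoint_zero])
      · rw [hg ⟨E, hE⟩ x (edgeLength E) ⟨(F.edgeLength_pos hE).le, le_rfl⟩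
          (by rw [hx, F.edgePoint_edgeLength hE]), hx]
        exact (hpL ⟨E, hE⟩).trans (by rw [F.edgePoint_edgeLength hE])
  · intro a b ha hb
    have h1 : a.1 = b.1 := by
      refine Subtype.ext (sub_eq_zero.1 (F.l2_definite _ ?_))
      have hmem : (a.1 : Poly2) - b.1 ∈ Poly ((k : ℤ) - 1) := sub_mem a.1.2 b.1.2
      have e1 := ha.face _ hmem
      have e2 := hb.face _ hmem
      have hi : ∀ c r : Poly2, IntegrableOn (fun x : Plane =>
          (MvPolynomial.eval (fun i => x i) c - q x) * MvPolynomial.eval (fun i => x i) r)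
          F.carrier := fun c r =>
        F.integrableOn_of_continuousOn
          (((continuous_eval_poly c).continuousOn.sub hq).mul
            (continuous_eval_poly r).continuousOn)
      have e3 : F.l2 ((a.1 : Poly2) - b.1) ((a.1 : Poly2) - b.1) = ∫ x in F.carrier,
        MvPolynomial.eval (fun i => x i) (((a.1 : Poly2) - b.1) * ((a.1 : Poly2) - b.1)) := rfl
      rw [e3]
      refine Eq.trans ?_ ((congrArg₂ (· - ·) e1 e2).trans (sub_self 0))
      rw [← integral_sub (hi _ _) (hi _ _)]
      congr 1
      funext x
      simp only [map_mul, map_sub]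
      ring
    have h2 : ∀ E : F.edges, (F.restrictEdges _ a.2 E : Polynomial ℝ) =
        F.restrictEdges _ b.2 E := by
      intro E
      have hL := F.edgeLength_pos E.2
      have hl : (0 : ℝ) ∈ Set.Icc 0 (edgeLength E) := ⟨le_rfl, hL.le⟩
      have hr : edgeLength E ∈ Set.Icc 0 (edgeLength E) := ⟨hL.le, le_rfl⟩
      refine sub_eq_zero.1 (edge_unique hL k _
        (sub_mem (F.restrictEdges _ a.2 E).2 (F.restrictEdges _ b.2 E).2) ?_ ?_ ?_)
      · rw [Polynomial.eval_sub, F.eval_restrictEdges _ _ E hl, F.eval_restrictEdges _ _ E hl,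
          ha.vertex E E.2 _ (Or.inl (edgePoint_zero _)),
          hb.vertex E E.2 _ (Or.inl (edgePoint_zero _)), sub_self]
      · rw [Polynomial.eval_sub, F.eval_restrictEdges _ _ E hr, F.eval_restrictEdges _ _ E hr,
          ha.vertex E E.2 _ (Or.inr (F.edgePoint_edgeLength E.2)),
          hb.vertex E E.2 _ (Or.inr (F.edgePoint_edgeLength E.2)), sub_self]
      · intro r hr
        have hi : ∀ c : Polynomial ℝ, IntervalIntegrable
            (fun s => (c.eval s - q (edgePoint E s)) * r.eval s) volume 0 (edgeLength E) :=
          fun c => ContinuousOn.intervalIntegrable (by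
            rw [Set.uIcc_of_le hL.le]
            exact (c.continuous.continuousOn.sub (hfr E)).mul r.continuous.continuousOn)
        have e1 := ha.edge E r hr
        have e2 := hb.edge E r hr
        refine Eq.trans ?_ ((congrArg₂ (· - ·) e1 e2).trans (sub_self 0))
        rw [← intervalIntegral.integral_sub (hi _) (hi _)]
        change ∫ s in (0 : ℝ)..edgeLength E, _ = _
        congr 1
        funext s
        simp only [Polynomial.eval_mul, Polynomial.eval_sub]
        ring
    refine Prod.ext h1 (Subtype.ext (ContinuousMap.ext fun x => ?_))
    have hx : (x : Plane) ∈ ⋃ E ∈ F.edges, segment ℝ E.1 E.2 := by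
      rw [F.iUnion_segment]; exact x.2
    obtain ⟨E, hE, hxE⟩ := Set.mem_iUnion₂.1 hx
    obtain ⟨s, hs, hxs⟩ := (F.mem_segment_iff hE _).1 hxE
    rw [F.restrictEdges_spec _ a.2 ⟨E, hE⟩ x s hs hxs,
      F.restrictEdges_spec _ b.2 ⟨E, hE⟩ x s hs hxs, h2]


/-- The interpolator on functions that are continuous on the closure of `F`. -/
def interpolator (k : ℕ) (q : Plane → ℝ) (hq : ContinuousOn q (closure F.carrier)) : F.XGrad k :=
  (F.existsUnique_interpolate k q hq).choose

/-! ### The discrete gradient -/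

/-- The full gradient `q ↦ G ∈ P_k(F)²` defined by
`∫_F G · w = -∫_F q_F div w + ∑_E ω_{FE} ∫_E q_{∂F} (w · n_{FE})` for all `w ∈ P_k(F)²`. -/
def fullGradient (k : ℕ) : F.XGrad k →ₗ[ℝ] VPoly (k : ℤ) :=
  riesz F.vl2 F.vl2_definite (VPoly (k : ℤ)) ∘ₗ Module.Dual.transpose (VPoly (k : ℤ)).subtype ∘ₗ
    LinearMap.mk₂ ℝ
      (fun (q : F.XGrad k) (w : VPoly2) =>
        -F.faceInt (q.1 * divergence w) + ∑ E : F.edges, F.omega E *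
          edgeInt E ((F.restrictEdges _ q.2 E : Polynomial ℝ) * normalTrace E w))
      (fun q q' w => by
        simp only [Prod.fst_add, Prod.snd_add, map_add, Submodule.coe_add, Pi.add_apply, add_mul,
          mul_add, Finset.sum_add_distrib]
        ring)
      (fun c q w => by
        simp only [Prod.smul_fst, Prod.smul_snd, map_smul, Submodule.coe_smul, Pi.smul_apply,
          smul_mul_assoc, smul_eq_mul, Finset.mul_sum, mul_add, mul_neg, mul_left_comm c])
      (fun q w w' => by
        simp only [map_add, mul_add, Finset.sum_add_distrib]
        ring)
      (fun c q w => by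
        simp only [map_smul, mul_smul_comm, smul_eq_mul, Finset.mul_sum, mul_add, mul_neg,
          mul_left_comm c])

theorem fullGradient_spec (k : ℕ) (q : F.XGrad k) (w : VPoly2) (hw : w ∈ VPoly (k : ℤ)) :
    F.vl2 (F.fullGradient k q) w =
      -F.faceInt (q.1 * divergence w) + ∑ E : F.edges, F.omega E *
        edgeInt E ((F.restrictEdges _ q.2 E : Polynomial ℝ) * normalTrace E w) :=
  riesz_spec F.vl2 F.vl2_definite (VPoly (k : ℤ)) _ ⟨w, hw⟩

theorem derivative_mem_edgePoly (ℓ : ℤ) (p : Polynomial ℝ) (hp : p ∈ EdgePoly (ℓ + 1)) :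
    Polynomial.derivative p ∈ EdgePoly ℓ := by
  intro n hn
  rw [Polynomial.coeff_derivative, hp (n + 1) (by push_cast; omega), zero_mul]

/-- The boundary gradient: on each edge `E`, the derivative in the direction `t_E`. -/
def bdryGradient (k : ℕ) : F.BdryPolyC ((k : ℤ) + 1) →ₗ[ℝ] F.BdryPoly (k : ℤ) :=
  LinearMap.pi fun E => (Polynomial.derivative.restrict (derivative_mem_edgePoly (k : ℤ))) ∘ₗ
    LinearMap.proj E ∘ₗ F.restrictEdges ((k : ℤ) + 1)

/-- The discrete gradient: the full gradient is projected on `R_{k-1}(F)` and on `R_k(F)^⊥`. -/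
def discreteGradient (k : ℕ) : F.XGrad k →ₗ[ℝ] F.XRot k :=
  LinearMap.prod
    ((Submodule.inclusion le_sup_left ∘ₗ F.vproj (Roly ((k : ℤ) - 1)) +
      Submodule.inclusion le_sup_right ∘ₗ F.vproj (F.RolyPerp (k : ℤ))) ∘ₗ
        (VPoly (k : ℤ)).subtype ∘ₗ F.fullGradient k)
    (F.bdryGradient k ∘ₗ LinearMap.snd ℝ _ _)

/-! ### The discrete scalar curl -/

/-- The discrete scalar curl `v ↦ C ∈ P_k(F)` defined by
`∫_F C r = ∫_F v_F · rot r - ∑_E ω_{FE} ∫_E v_{∂F} r` for all `r ∈ P_k(F)`. -/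
def discreteCurl (k : ℕ) : F.XRot k →ₗ[ℝ] Poly (k : ℤ) :=
  riesz F.l2 F.l2_definite (Poly (k : ℤ)) ∘ₗ Module.Dual.transpose (Poly (k : ℤ)).subtype ∘ₗ
    LinearMap.mk₂ ℝ
      (fun (v : F.XRot k) (r : Poly2) =>
        F.vl2 v.1 (vrot r) - ∑ E : F.edges, F.omega E *
          edgeInt E ((v.2 E : Polynomial ℝ) * edgeTrace E r))
      (fun v v' r => by
        simp only [Prod.fst_add, Prod.snd_add, map_add, Submodule.coe_add, Pi.add_apply, add_mul,
          mul_add, Finset.sum_add_distrib, LinearMap.add_apply]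
        ring)
      (fun c v r => by
        simp only [Prod.smul_fst, Prod.smul_snd, map_smul, Submodule.coe_smul, Pi.smul_apply,
          smul_mul_assoc, smul_eq_mul, Finset.mul_sum, mul_sub, mul_left_comm c,
          LinearMap.smul_apply])
      (fun v r r' => by
        simp only [map_add, mul_add, Finset.sum_add_distrib]
        ring)
      (fun c v r => by
        simp only [map_smul, mul_smul_comm, smul_eq_mul, Finset.mul_sum, mul_sub,
          mul_left_comm c])

theorem discreteCurl_spec (k : ℕ) (v : F.XRot k) (r : Poly2) (hr : r ∈ Poly (k : ℤ)) :
    F.l2 (F.discreteCurl k v) r =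
      F.vl2 v.1 (vrot r) - ∑ E : F.edges, F.omega E *
        edgeInt E ((v.2 E : Polynomial ℝ) * edgeTrace E r) :=
  riesz_spec F.l2 F.l2_definite (Poly (k : ℤ)) _ ⟨r, hr⟩

end OrientedPolygon

end DiscreteDeRham

end

/-!
The proof rests on two facts about the polygon `F`; the rest is linear algebra.

*Divergence theorem* (`faceInt_divergence`): `∫_F div w = ∑_E ω_{FE} ∫_E w · n_{FE}` for polynomial
fields `w`. It follows from the fundamental theorem of calculus on almost every line parallel to a
coordinate axis, followed by Fubini's theorem. On a line that avoids the vertices, the indicator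
function of `F` is piecewise constant with jumps at the crossings with the edges
(`setIntegral_deriv_eq_sum_jumps`), and these jumps are given by `ω_{FE}` since `F` lies on exactly
one side of each edge, by the Lipschitz charts, and on the same one all along it
(`eventually_mem_of_normalCoord_mul_omega`).

*The cycles of the boundary graph are the multiples of `ω`.* That `ω` is a cycle
(`sum_omega_mul_sub`) is the divergence theorem for `rot p`, where `p` is a polynomial with given
values at the vertices. There is no other cycle up to a factor (`IsCycle.exists_eq_mul_omega`)
because the boundary is connected and, being locally a graph, has at most two edges at each vertex
(`eq_or_eq_of_common_vertex`). By duality, increments `b_E` along the edges with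
`∑_E ω_{FE} b_E = 0` come from values at the vertices (`exists_potential`).

On the polynomial side, the kernel of `div` on `P_k(F)²` is `R_k(F)`, so `div` is an isomorphism
from `R_k(F)^⊥` onto `P_{k-1}(F)` (`divergenceEquiv`).

Exactness follows. If the discrete gradient of `q` vanishes, then `q_{∂F}` is a constant `c` because
`∂F` is connected, and testing against `R_k(F)^⊥` shows that `q_F` is the projection of `c`. The
discrete curl of a discrete gradient vanishes by integration by parts along the cycle `∂F`. If the
discrete curl of `v` vanishes, testing with `r = 1` gives a potential `q_{∂F}` of `v_{∂F}`, the
products with `R_k(F)^⊥` then determine `q_F` through `div`, and those with `R_{k-1}(F)` agree by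
integration by parts. Finally, if `r ∈ P_k(F)` is orthogonal to the image of the discrete curl,
then `v = (rot r, 0)` shows that `r` is constant, and `v = (0, ω)` that this constant times the
perimeter is zero.
-/

noncomputable section

namespace DiscreteDeRham

/-! ### Primitives of bivariate polynomials -/

/-- The primitive in the `i`-th variable that vanishes where this variable does:
`x^d ↦ x_i x^d / (d_i + 1)`. -/
def primitive (i : Fin 2) : Poly2 →ₗ[ℝ] Poly2 :=
  (MvPolynomial.basisMonomials (Fin 2) ℝ).constr ℝ fun d =>
    MvPolynomial.monomial (d + Finsupp.single i 1) ((d i : ℝ) + 1)⁻¹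

theorem primitive_monomial (i : Fin 2) (d : Fin 2 →₀ ℕ) (a : ℝ) :
    primitive i (MvPolynomial.monomial d a) =
      MvPolynomial.monomial (d + Finsupp.single i 1) (a * ((d i : ℝ) + 1)⁻¹) := by
  have h := (MvPolynomial.basisMonomials (Fin 2) ℝ).constr_basis ℝ (fun d =>
    MvPolynomial.monomial (d + Finsupp.single i 1) ((d i : ℝ) + 1)⁻¹) d
  have e : MvPolynomial.monomial d a = a • (MvPolynomial.monomial d (1 : ℝ)) := by
    rw [MvPolynomial.smul_monomial, smul_eq_mul, mul_one]
  rw [MvPolynomial.coe_basisMonomials] at h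
  rw [e, map_smul, primitive, h, MvPolynomial.smul_monomial, smul_eq_mul]

theorem pderiv_primitive (i : Fin 2) (p : Poly2) :
    MvPolynomial.pderiv i (primitive i p) = p := by
  induction p using MvPolynomial.induction_on' with
  | monomial d a =>
    have : (d i : ℝ) + 1 ≠ 0 := by positivity
    rw [primitive_monomial, MvPolynomial.pderiv_monomial]
    simp [this]
  | add p q hp hq => simp [hp, hq]

theorem pderiv_primitive_of_ne {i j : Fin 2} (hij : i ≠ j) (p : Poly2) :
    MvPolynomial.pderiv j (primitive i p) = primitive i (MvPolynomial.pderiv j p) := by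
  induction p using MvPolynomial.induction_on' with
  | monomial d a =>
    rw [primitive_monomial, MvPolynomial.pderiv_monomial, MvPolynomial.pderiv_monomial,
      primitive_monomial]
    by_cases hd : d j = 0
    · simp [hd, hij]
    · have hle : Finsupp.single j 1 ≤ d := by
        rw [Finsupp.single_le_iff]; omega
      have e : d + Finsupp.single i 1 - Finsupp.single j 1 =
          d - Finsupp.single j 1 + Finsupp.single i 1 := by
        rw [tsub_add_eq_add_tsub hle]
      rw [e]
      congr 1
      simp [hij, hij.symm]
      ring
  | add p q hp hq => simp [hp, hq]

theorem Poly_mono {ℓ ℓ' : ℤ} (h : ℓ ≤ ℓ') : Poly ℓ ≤ Poly ℓ' := fun _ hp d hd => hp d (by omega)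

theorem primitive_mem_Poly (i : Fin 2) {ℓ : ℤ} {p : Poly2} (hp : p ∈ Poly ℓ) :
    primitive i p ∈ Poly (ℓ + 1) := by
  rw [p.as_sum, map_sum]
  refine sum_mem fun d hd => ?_
  rw [primitive_monomial]
  intro e he
  rw [MvPolynomial.coeff_monomial, if_neg]
  rintro rfl
  refine MvPolynomial.mem_support_iff.1 hd (hp d ?_)
  rw [map_add, Finsupp.degree_single] at he
  push_cast at he
  omega

theorem pderiv_mem_Poly (i : Fin 2) {ℓ : ℤ} {p : Poly2} (hp : p ∈ Poly (ℓ + 1)) :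
    MvPolynomial.pderiv i p ∈ Poly ℓ := by
  intro d hd
  rw [MvPolynomial.coeff_pderiv, hp, zero_mul]
  rw [map_add, Finsupp.degree_single]
  push_cast
  omega

/-! ### The polynomial de Rham complex -/

theorem mem_VPoly {ℓ : ℤ} {w : VPoly2} : w ∈ VPoly ℓ ↔ ∀ i, w i ∈ Poly ℓ := by
  simp [VPoly, Submodule.mem_pi]

theorem divergence_apply (w : VPoly2) :
    divergence w = MvPolynomial.pderiv 0 (w 0) + MvPolynomial.pderiv 1 (w 1) := by
  simp [divergence]

theorem vrot_zero_apply (p : Poly2) : vrot p 0 = MvPolynomial.pderiv 1 p := rfl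

theorem vrot_one_apply (p : Poly2) : vrot p 1 = -MvPolynomial.pderiv 0 p := rfl

theorem pderiv_pderiv_comm (p : Poly2) : MvPolynomial.pderiv 0 (MvPolynomial.pderiv 1 p) =
    MvPolynomial.pderiv 1 (MvPolynomial.pderiv 0 p) := by
  ext d
  simp only [MvPolynomial.coeff_pderiv]
  rw [add_right_comm]
  simp
  ring

theorem divergence_vrot (p : Poly2) : divergence (vrot p) = 0 := by
  rw [divergence_apply, vrot_zero_apply, vrot_one_apply, map_neg, pderiv_pderiv_comm,
    add_neg_cancel]

theorem vrot_mem_VPoly {ℓ : ℤ} {p : Poly2} (hp : p ∈ Poly (ℓ + 1)) : vrot p ∈ VPoly ℓ := by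
  rw [mem_VPoly, Fin.forall_fin_two, vrot_zero_apply, vrot_one_apply]
  exact ⟨pderiv_mem_Poly 1 hp, neg_mem (pderiv_mem_Poly 0 hp)⟩

theorem Roly_le_VPoly (ℓ : ℤ) : Roly ℓ ≤ VPoly ℓ := by
  rintro _ ⟨p, hp, rfl⟩
  exact vrot_mem_VPoly hp

theorem Roly_mono {ℓ ℓ' : ℤ} (h : ℓ ≤ ℓ') : Roly ℓ ≤ Roly ℓ' :=
  Submodule.map_mono (Poly_mono (by omega))

theorem divergence_mem_Poly {ℓ : ℤ} {w : VPoly2} (hw : w ∈ VPoly ℓ) :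
    divergence w ∈ Poly (ℓ - 1) := by
  rw [mem_VPoly] at hw
  rw [divergence_apply]
  exact add_mem (pderiv_mem_Poly 0 (by simpa using hw 0)) (pderiv_mem_Poly 1 (by simpa using hw 1))

theorem exists_divergence_eq {ℓ : ℤ} {p : Poly2} (hp : p ∈ Poly (ℓ - 1)) :
    ∃ w ∈ VPoly ℓ, divergence w = p := by
  refine ⟨![primitive 0 p, 0], ?_, ?_⟩
  · rw [mem_VPoly, Fin.forall_fin_two]
    exact ⟨by simpa using primitive_mem_Poly 0 hp, zero_mem _⟩
  · rw [divergence_apply]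
    simp [pderiv_primitive]

/-- The polynomial Poincaré lemma. -/
theorem mem_Roly_of_divergence_eq_zero {ℓ : ℤ} {w : VPoly2} (hw : w ∈ VPoly ℓ)
    (h : divergence w = 0) : w ∈ Roly ℓ := by
  rw [mem_VPoly] at hw
  rw [divergence_apply] at h
  -- `vrot (primitive 1 (w 0))` is right in the first component, and its error in the second one
  -- depends on the first variable only.
  set e : Poly2 := w 1 + MvPolynomial.pderiv 0 (primitive 1 (w 0)) with he
  have he1 : MvPolynomial.pderiv 1 e = 0 := by
    rw [he, map_add, ← pderiv_pderiv_comm, pderiv_primitive, add_comm, h]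
  have hemem : e ∈ Poly ℓ := add_mem (hw 1) (pderiv_mem_Poly 0 (primitive_mem_Poly 1 (hw 0)))
  refine ⟨primitive 1 (w 0) - primitive 0 e,
    sub_mem (primitive_mem_Poly 1 (hw 0)) (primitive_mem_Poly 0 hemem), ?_⟩
  funext i
  fin_cases i
  · change vrot _ 0 = w 0
    rw [vrot_zero_apply, map_sub, pderiv_primitive, pderiv_primitive_of_ne (by decide), he1,
      map_zero, sub_zero]
  · change vrot _ 1 = w 1
    rw [vrot_one_apply, map_sub, pderiv_primitive, he]
    abel

theorem eq_C_of_vrot_eq_zero {p : Poly2} (h : vrot p = 0) :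
    p = MvPolynomial.C (MvPolynomial.coeff 0 p) := by
  have h1 : MvPolynomial.pderiv 1 p = 0 := by rw [← vrot_zero_apply, h, Pi.zero_apply]
  have h0 : MvPolynomial.pderiv 0 p = 0 := by
    rw [← neg_eq_zero, ← vrot_one_apply, h, Pi.zero_apply]
  have hp : ∀ i, MvPolynomial.pderiv i p = 0 := Fin.forall_fin_two.2 ⟨h0, h1⟩
  ext d
  rw [MvPolynomial.coeff_C]
  split_ifs with hd
  · rw [hd]
  · obtain ⟨i, hi⟩ : ∃ i, d i ≠ 0 := by
      by_contra! hc
      exact hd (Finsupp.ext fun i => (hc i).symm)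
    have hle : Finsupp.single i 1 ≤ d := by
      rw [Finsupp.single_le_iff]; omega
    have hc := MvPolynomial.coeff_pderiv (i := i) p (d - Finsupp.single i 1)
    rw [hp i, tsub_add_cancel_of_le hle, MvPolynomial.coeff_zero] at hc
    refine (mul_eq_zero.1 hc.symm).resolve_right ?_
    positivity

/-! ### Traces on an edge -/

theorem edgeInt_derivative (E : Plane × Plane) (p : Polynomial ℝ) :
    edgeInt E (Polynomial.derivative p) = p.eval (edgeLength E) - p.eval 0 :=
  intervalIntegral.integral_eq_sub_of_hasDerivAt (fun x _ => p.hasDerivAt x)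
    ((Polynomial.continuous _).intervalIntegrable _ _)

/-- Integration by parts on an edge. -/
theorem edgeInt_mul_derivative (E : Plane × Plane) (p q : Polynomial ℝ) :
    edgeInt E (p * Polynomial.derivative q) = (p * q).eval (edgeLength E) - (p * q).eval 0 -
      edgeInt E (Polynomial.derivative p * q) := by
  rw [← edgeInt_derivative, Polynomial.derivative_mul, map_add]
  ring

theorem derivative_edgeTrace (E : Plane × Plane) (p : Poly2) :
    Polynomial.derivative (edgeTrace E p) =
      ∑ i, tangent E i • edgeTrace E (MvPolynomial.pderiv i p) := by
  induction p using MvPolynomial.induction_on with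
  | C a => simp [edgeTrace]
  | add p q hp hq => simp only [map_add, hp, hq, smul_add, Finset.sum_add_distrib]
  | mul_X p i hp =>
    rw [map_mul, Polynomial.derivative_mul, hp]
    simp only [Derivation.leibniz, map_add, smul_add, Finset.sum_add_distrib, smul_eq_mul, map_mul]
    rw [add_comm]
    congr 1
    · simp only [Fin.sum_univ_two]
      fin_cases i <;> simp [edgeTrace, MvPolynomial.pderiv_X, Polynomial.smul_eq_C_mul,
        mul_comm _ (Polynomial.C _)]
    · rw [Finset.sum_mul]
      exact Finset.sum_congr rfl fun j _ => by
        rw [mul_comm (edgeTrace E (MvPolynomial.X i)), smul_mul_assoc]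

theorem normalTrace_apply (E : Plane × Plane) (w : VPoly2) :
    normalTrace E w = ∑ i, normal E i • edgeTrace E (w i) := by
  simp [normalTrace]

theorem normalTrace_vrot (E : Plane × Plane) (p : Poly2) :
    normalTrace E (vrot p) = -Polynomial.derivative (edgeTrace E p) := by
  rw [derivative_edgeTrace, normalTrace_apply]
  simp only [Fin.sum_univ_two, vrot_zero_apply, vrot_one_apply, normal]
  simp

/-! ### The fundamental theorem of calculus on a bounded subset of the line with finite frontier -/

/-- The jump at `a` of the indicator function of `U`, from left to right, is `c = ± 1`. -/
def HasJump (U : Set ℝ) (a c : ℝ) : Prop :=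
  (c = 1 ∧ (∀ᶠ y in 𝓝[<] a, y ∉ U) ∧ ∀ᶠ y in 𝓝[>] a, y ∈ U) ∨
    (c = -1 ∧ (∀ᶠ y in 𝓝[<] a, y ∈ U) ∧ ∀ᶠ y in 𝓝[>] a, y ∉ U)

/-- A function on the line that is constant on a punctured neighbourhood of each point takes the
same value near all points. -/
theorem const_of_eventually_const_punctured {ψ : ℝ → ℝ} {a : ℝ → ℝ}
    (h : ∀ x, ∀ᶠ y in 𝓝[≠] x, ψ y = a x) (x x' : ℝ) : a x = a x' := by
  have hloc : IsLocallyConstant a := by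
    rw [IsLocallyConstant.iff_eventually_eq]
    intro x
    have h1 := eventually_eventually_nhds.2 (eventually_nhdsWithin_iff.1 (h x))
    filter_upwards [h1] with y hy
    by_cases hxy : y = x
    · rw [hxy]
    · have h2 : ∀ᶠ z in 𝓝[≠] y, ψ z = a x := by
        filter_upwards [hy.filter_mono nhdsWithin_le_nhds,
          nhdsWithin_le_nhds (isOpen_compl_singleton.mem_nhds hxy)] with z hz hzx using hz hzx
      obtain ⟨z, hz, hz'⟩ := ((h y).and h2).exists
      rw [← hz, hz']
  exact hloc.apply_eq_of_isPreconnected isPreconnected_univ (Set.mem_univ _) (Set.mem_univ _)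

/-- A piecewise constant function that vanishes near `-∞` is the sum of its jumps. -/
theorem indicator_eq_sum_jumps {ι : Type*} {U : Set ℝ} (hU : Bornology.IsBounded U) (Z : Finset ι)
    {z c : ι → ℝ} (hz : Set.InjOn z Z)
    (hreg : ∀ x, (∀ i ∈ Z, z i ≠ x) → (∀ᶠ y in 𝓝 x, y ∈ U) ∨ ∀ᶠ y in 𝓝 x, y ∉ U)
    (hjump : ∀ i ∈ Z, HasJump U (z i) (c i)) {x : ℝ} (hx : ∀ i ∈ Z, z i ≠ x) :
    U.indicator 1 x = ∑ i ∈ Z, c i * (Set.Ioi (z i)).indicator 1 x := by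
  -- the difference `ψ` of the two sides has no jump, neither at the points `z i` nor elsewhere
  set s : ι → ℝ → ℝ := fun i y => c i * (Set.Ioi (z i)).indicator 1 y with hs
  set ψ : ℝ → ℝ := fun y => U.indicator 1 y - ∑ i ∈ Z, s i y with hψ
  have hsc : ∀ i x, z i ≠ x → ∀ᶠ y in 𝓝 x, s i y = s i x := by
    intro i x hx
    rcases lt_or_gt_of_ne hx with h | h
    · filter_upwards [Ioi_mem_nhds h] with y hy
      simp [hs, Set.mem_Ioi.1 hy, h]
    · filter_upwards [Iio_mem_nhds h] with y hy
      simp [hs, (Set.mem_Iio.1 hy).not_gt, h.not_gt]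
  have key : ∀ x, ∃ a, (∀ᶠ y in 𝓝[≠] x, ψ y = a) ∧ ((∀ i ∈ Z, z i ≠ x) → ψ x = a) := by
    intro x
    by_cases hx : ∀ i ∈ Z, z i ≠ x
    · refine ⟨ψ x, Eventually.filter_mono nhdsWithin_le_nhds ?_, fun _ => rfl⟩
      have h1 : ∀ᶠ y in 𝓝 x, ∀ i ∈ Z, s i y = s i x :=
        (Filter.eventually_all_finset Z).2 fun i hi => hsc i x (hx i hi)
      have h2 : ∀ᶠ y in 𝓝 x, U.indicator (1 : ℝ → ℝ) y = U.indicator 1 x := by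
        rcases hreg x hx with h | h
        · filter_upwards [h] with y hy
          simp [hy, h.self_of_nhds]
        · filter_upwards [h] with y hy
          simp [hy, h.self_of_nhds]
      filter_upwards [h1, h2] with y hy1 hy2
      simp only [hψ]
      rw [hy2, Finset.sum_congr rfl hy1]
    · push Not at hx
      obtain ⟨i₀, hi₀, rfl⟩ := hx
      classical
      have h1 : ∀ᶠ y in 𝓝 (z i₀), ∀ i ∈ Z.erase i₀, s i y = s i (z i₀) :=
        (Filter.eventually_all_finset _).2 fun i hi => hsc i _ fun h =>
          (Finset.ne_of_mem_erase hi) (hz (Finset.mem_of_mem_erase hi) hi₀ h)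
      have h2 : ∀ y, ψ y = U.indicator 1 y - (s i₀ y + ∑ i ∈ Z.erase i₀, s i y) := fun y => by
        rw [hψ, Finset.add_sum_erase Z (fun i => s i y) hi₀]
      refine ⟨(if c i₀ = 1 then 0 else 1) -
        ∑ i ∈ Z.erase i₀, s i (z i₀), ?_, fun h => absurd rfl (h i₀ hi₀)⟩
      rw [← nhdsLT_sup_nhdsGT, eventually_sup]
      have hne : (-1 : ℝ) ≠ 1 := by norm_num
      rcases hjump i₀ hi₀ with ⟨hc, hl, hr⟩ | ⟨hc, hl, hr⟩
      · constructor
        · filter_upwards [hl, h1.filter_mono nhdsWithin_le_nhds, self_mem_nhdsWithin]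
            with y hy hy' hlt
          rw [h2, Finset.sum_congr rfl hy']
          simp [hs, hy, hc, (Set.mem_Iio.1 hlt).not_gt]
        · filter_upwards [hr, h1.filter_mono nhdsWithin_le_nhds, self_mem_nhdsWithin]
            with y hy hy' hlt
          rw [h2, Finset.sum_congr rfl hy']
          simp [hs, hy, hc, Set.mem_Ioi.1 hlt]
      · constructor
        · filter_upwards [hl, h1.filter_mono nhdsWithin_le_nhds, self_mem_nhdsWithin]
            with y hy hy' hlt
          rw [h2, Finset.sum_congr rfl hy']
          simp [hs, hy, hc, hne, (Set.mem_Iio.1 hlt).not_gt]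
        · filter_upwards [hr, h1.filter_mono nhdsWithin_le_nhds, self_mem_nhdsWithin]
            with y hy hy' hlt
          rw [h2, Finset.sum_congr rfl hy']
          simp [hs, hy, hc, hne, Set.mem_Ioi.1 hlt]
          ring
  choose a ha ha' using key
  -- the constant value of `ψ` is read off to the left of everything
  obtain ⟨m, hm⟩ : ∃ m, m ∈ lowerBounds (U ∪ z '' Z) :=
    (hU.union (Z.finite_toSet.image z).isBounded).bddBelow
  have hψm : ψ (m - 1) = 0 := by
    have h1 : m - 1 ∉ U := fun h => by linarith [hm (Or.inl h)]
    have h2 : ∀ i ∈ Z, s i (m - 1) = 0 := fun i hi => by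
      have : m ≤ z i := hm (Or.inr ⟨i, hi, rfl⟩)
      have h3 : ¬ z i < m - 1 := by linarith
      simp [hs, h3]
    simp only [hψ]
    rw [Finset.sum_eq_zero h2]
    simp [h1]
  have hne : ∀ i ∈ Z, z i ≠ m - 1 := fun i hi => by
    have : m ≤ z i := hm (Or.inr ⟨i, hi, rfl⟩)
    intro h
    linarith
  have h0 : ψ x = 0 := by
    rw [ha' x hx, const_of_eventually_const_punctured ha x (m - 1), ← ha' _ hne, hψm]
  exact sub_eq_zero.1 h0

/-- The fundamental theorem of calculus on a bounded set `U` with finitely many boundary points: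
each indicator function of a half-line in the decomposition of that of `U` contributes the increment of
`f` up to a common point on the right of `U`, whose contribution vanishes since the jumps add up to
zero. -/
theorem setIntegral_deriv_eq_sum_jumps {ι : Type*} {U : Set ℝ} (hU : Bornology.IsBounded U)
    (hUm : MeasurableSet U) (Z : Finset ι)
    {z c : ι → ℝ} (hz : Set.InjOn z Z)
    (hreg : ∀ x, (∀ i ∈ Z, z i ≠ x) → (∀ᶠ y in 𝓝 x, y ∈ U) ∨ ∀ᶠ y in 𝓝 x, y ∉ U)
    (hjump : ∀ i ∈ Z, HasJump U (z i) (c i)) {f f' : ℝ → ℝ}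
    (hf : ∀ x, HasDerivAt f (f' x) x) (hf' : Continuous f') :
    ∫ x in U, f' x = -∑ i ∈ Z, c i * f (z i) := by
  have hB := hU.union (Z.finite_toSet.image z).isBounded
  obtain ⟨m, hm⟩ := hB.bddBelow
  obtain ⟨M₀, hM₀⟩ := hB.bddAbove
  set M := M₀ + 1 with hM
  have hzM : ∀ i ∈ Z, z i < M := fun i hi => by
    have : z i ≤ M₀ := hM₀ (Or.inr ⟨i, hi, rfl⟩)
    linarith
  have hzm : ∀ i ∈ Z, m ≤ z i := fun i hi => hm (Or.inr ⟨i, hi, rfl⟩)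
  have hMU : M ∉ U := fun h => by linarith [hM₀ (Or.inl h)]
  have hsum : ∑ i ∈ Z, c i = 0 := by
    have h := indicator_eq_sum_jumps hU Z hz hreg hjump (x := M) fun i hi => (hzM i hi).ne
    rw [Set.indicator_of_notMem hMU] at h
    rw [h]
    refine Finset.sum_congr rfl fun i hi => ?_
    rw [Set.indicator_of_mem (Set.mem_Ioi.2 (hzM i hi)), Pi.one_apply, mul_one]
  have hsub : Set.Ioc (m - 1) M ∩ U = U := by
    refine Set.inter_eq_right.2 fun x hx => ⟨?_, ?_⟩
    · linarith [hm (Or.inl hx)]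
    · linarith [hM₀ (Or.inl hx)]
  have hae : U.indicator f' =ᵐ[volume.restrict (Set.Ioc (m - 1) M)]
      fun x => ∑ i ∈ Z, c i * (Set.Ioi (z i)).indicator f' x := by
    have hnull : (z '' Z)ᶜ ∈ ae (volume.restrict (Set.Ioc (m - 1) M)) :=
      compl_mem_ae_iff.2 ((Z.finite_toSet.image z).measure_zero _)
    filter_upwards [hnull] with x hx
    have h := indicator_eq_sum_jumps hU Z hz hreg hjump (x := x) fun i hi h => hx ⟨i, hi, h⟩
    have e : ∀ S : Set ℝ, S.indicator f' x = S.indicator 1 x * f' x := fun S => by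
      by_cases hxS : x ∈ S <;> simp [hxS]
    rw [e, h, Finset.sum_mul]
    exact Finset.sum_congr rfl fun i _ => by rw [e (Set.Ioi (z i)), mul_assoc]
  have hint : IntegrableOn f' (Set.Ioc (m - 1) M) :=
    (hf'.integrableOn_Icc).mono_set Set.Ioc_subset_Icc_self
  calc ∫ x in U, f' x = ∫ x in Set.Ioc (m - 1) M, U.indicator f' x := by
        rw [setIntegral_indicator hUm, hsub]
    _ = ∫ x in Set.Ioc (m - 1) M, ∑ i ∈ Z, c i * (Set.Ioi (z i)).indicator f' x :=
        integral_congr_ae hae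
    _ = ∑ i ∈ Z, c i * (f M - f (z i)) := by
        rw [integral_finsetSum _ fun i _ =>
          (hint.integrable.indicator measurableSet_Ioi).const_mul _]
        refine Finset.sum_congr rfl fun i hi => ?_
        rw [integral_const_mul, setIntegral_indicator measurableSet_Ioi]
        have e : Set.Ioc (m - 1) M ∩ Set.Ioi (z i) = Set.Ioc (z i) M := by
          ext x
          have := hzm i hi
          simp only [Set.mem_inter_iff, Set.mem_Ioc, Set.mem_Ioi]
          constructor
          · rintro ⟨⟨_, h⟩, h'⟩; exact ⟨h', h⟩
          · rintro ⟨h', h⟩; exact ⟨⟨by linarith, h⟩, h'⟩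
        rw [e, ← intervalIntegral.integral_of_le (hzM i hi).le,
          intervalIntegral.integral_eq_sub_of_hasDerivAt (fun x _ => hf x)
            (hf'.intervalIntegrable _ _)]
    _ = -∑ i ∈ Z, c i * f (z i) := by
        simp only [mul_sub, Finset.sum_sub_distrib, ← Finset.sum_mul, hsum]
        ring

/-! ### Lipschitz charts -/

/-- A point of the plane is determined by its coordinates in an orthonormal basis. -/
theorem eq_of_inner_eq {e₁ e₂ : Plane} (h₁ : ‖e₁‖ = 1) (h₂ : ‖e₂‖ = 1) (h : inner ℝ e₁ e₂ = 0)
    {x y : Plane} (hx : inner ℝ e₁ x = inner ℝ e₁ y) (hy : inner ℝ e₂ x = inner ℝ e₂ y) :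
    x = y := by
  have n₁ : e₁ 0 * e₁ 0 + e₁ 1 * e₁ 1 = 1 := by
    have := real_inner_self_eq_norm_sq e₁
    rw [h₁, PiLp.inner_apply] at this
    simpa [Fin.sum_univ_two, sq] using this
  have n₂ : e₂ 0 * e₂ 0 + e₂ 1 * e₂ 1 = 1 := by
    have := real_inner_self_eq_norm_sq e₂
    rw [h₂, PiLp.inner_apply] at this
    simpa [Fin.sum_univ_two, sq] using this
  simp only [PiLp.inner_apply, Fin.sum_univ_two, RCLike.inner_apply, conj_trivial] at h hx hy
  have hdet : (e₁ 0 * e₂ 1 - e₁ 1 * e₂ 0) * (e₁ 0 * e₂ 1 - e₁ 1 * e₂ 0) = 1 := by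
    linear_combination (e₂ 0 * e₂ 0 + e₂ 1 * e₂ 1) * n₁ + n₂ - (e₂ 0 * e₁ 0 + e₂ 1 * e₁ 1) * h
  have hdet0 : e₁ 0 * e₂ 1 - e₁ 1 * e₂ 0 ≠ 0 := fun h0 => by rw [h0] at hdet; norm_num at hdet
  ext i
  refine mul_left_cancel₀ hdet0 ?_
  fin_cases i
  · change _ * x 0 = _ * y 0
    linear_combination e₂ 1 * hx - e₁ 1 * hy
  · change _ * x 1 = _ * y 1
    linear_combination e₁ 0 * hy - e₂ 0 * hx

/-- Near a point of a Lipschitz boundary, the open set is the strict epigraph of a function in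
orthonormal coordinates, and the frontier lies in the graph. -/
theorem HasLipschitzBoundary.exists_chart {Ω : Set Plane} (hΩ : HasLipschitzBoundary Ω)
    (ho : IsOpen Ω) {x : Plane} (hx : x ∈ frontier Ω) :
    ∃ e₁ e₂ : Plane, ‖e₁‖ = 1 ∧ ‖e₂‖ = 1 ∧ inner ℝ e₁ e₂ = 0 ∧ ∃ φ : ℝ → ℝ,
      ∀ᶠ y in 𝓝 x, (y ∈ Ω ↔ φ (inner ℝ e₁ y) < inner ℝ e₂ y) ∧
        (y ∈ frontier Ω → inner ℝ e₂ y = φ (inner ℝ e₁ y)) := by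
  obtain ⟨r, hr, e₁, e₂, h₁, h₂, h, K, φ, hφ, hchart⟩ := hΩ x hx
  refine ⟨e₁, e₂, h₁, h₂, h, φ, ?_⟩
  filter_upwards [Metric.isOpen_ball.mem_nhds (Metric.mem_ball_self hr)] with y hy
  refine ⟨hchart y hy, fun hyf => ?_⟩
  rw [ho.frontier_eq] at hyf
  refine le_antisymm (not_lt.1 fun hlt => hyf.2 ((hchart y hy).2 hlt)) (not_lt.1 fun hlt => ?_)
  have hφc := hφ.continuous
  have hopen : IsOpen {y : Plane | inner ℝ e₂ y < φ (inner ℝ e₁ y)} :=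
    isOpen_lt (by fun_prop) (by fun_prop)
  obtain ⟨z, ⟨hz, hz'⟩, hzΩ⟩ := mem_closure_iff_nhds.1 hyf.1 _
    (inter_mem (hopen.mem_nhds hlt) (Metric.isOpen_ball.mem_nhds hy))
  exact lt_asymm ((hchart z hz').1 hzΩ) hz

/-! ### The two sides of an edge -/

theorem isClosed_segment (x y : Plane) : IsClosed (segment ℝ x y) := by
  rw [segment_eq_image_lineMap]
  exact (isCompact_Icc.image AffineMap.lineMap_continuous).isClosed

theorem subset_or_disjoint_of_isPreconnected {Ω S : Set Plane} (hΩ : IsOpen Ω)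
    (hS : IsPreconnected S) (h : Disjoint S (frontier Ω)) : S ⊆ Ω ∨ Disjoint S Ω := by
  have hcov : S ⊆ Ω ∪ (closure Ω)ᶜ := by
    intro x hx
    by_cases hx' : x ∈ Ω
    · exact Or.inl hx'
    · refine Or.inr fun hc => Set.disjoint_left.1 h hx ?_
      rw [hΩ.frontier_eq]
      exact ⟨hc, hx'⟩
  rcases hS.subset_or_subset hΩ isClosed_closure.isOpen_compl
    (Set.disjoint_left.2 fun x hx hx' => hx' (subset_closure hx)) hcov with h | h
  · exact Or.inl h
  · exact Or.inr (Set.disjoint_left.2 fun x hx hx' => h hx (subset_closure hx'))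

/-- The signed distance to the line of `E`, positive on the side to which the normal points. -/
def normalCoord (E : Plane × Plane) (y : Plane) : ℝ := ∑ i, normal E i * (y i - E.1 i)

theorem normalCoord_add_smul (E : Plane × Plane) (y v : Plane) (ε : ℝ) :
    normalCoord E (y + ε • v) = normalCoord E y + ε * ∑ i, normal E i * v i := by
  simp [normalCoord, Fin.sum_univ_two]
  ring

theorem normalCoord_smul_add_smul (E : Plane × Plane) (x y : Plane) {a b : ℝ} (hab : a + b = 1) :
    normalCoord E (a • x + b • y) = a * normalCoord E x + b * normalCoord E y := by
  obtain rfl : a = 1 - b := by linarith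
  simp [normalCoord, Fin.sum_univ_two]
  ring

theorem convex_normalCoord_preimage (E : Plane × Plane) {s : Set ℝ} (hs : Convex ℝ s) :
    Convex ℝ (normalCoord E ⁻¹' s) := by
  intro x hx y hy a b ha hb hab
  rw [Set.mem_preimage, normalCoord_smul_add_smul E x y hab]
  exact hs hx hy ha hb hab

namespace OrientedPolygon

variable (F : OrientedPolygon) {E : Plane × Plane}

theorem tangent_sq_add_sq (hE : E ∈ F.edges) :
    tangent E 0 * tangent E 0 + tangent E 1 * tangent E 1 = 1 := by
  have hL := F.edgeLength_pos hE
  have hn : ‖tangent E‖ = 1 := by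
    rw [tangent, norm_smul, norm_inv, ← dist_eq_norm, dist_comm]
    change ‖edgeLength E‖⁻¹ * edgeLength E = 1
    rw [Real.norm_of_nonneg hL.le, inv_mul_cancel₀ hL.ne']
  have := real_inner_self_eq_norm_sq (tangent E)
  rw [hn, PiLp.inner_apply] at this
  simpa [Fin.sum_univ_two, sq] using this

theorem normalCoord_edgePoint (E : Plane × Plane) (s : ℝ) : normalCoord E (edgePoint E s) = 0 := by
  simp [normalCoord, edgePoint, normal, Fin.sum_univ_two]
  ring

theorem normalCoord_edgePoint_add_normal (hE : E ∈ F.edges) (s ε : ℝ) :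
    normalCoord E (edgePoint E s + ε • normal E) = ε := by
  have := F.tangent_sq_add_sq hE
  rw [normalCoord_add_smul, normalCoord_edgePoint]
  simp [normal, Fin.sum_univ_two]
  linear_combination ε * this

theorem continuous_edgePoint (E : Plane × Plane) : Continuous (edgePoint E) := by
  unfold edgePoint; fun_prop

theorem eq_edgePoint_of_normalCoord_eq_zero (hE : E ∈ F.edges) {y : Plane}
    (hy : normalCoord E y = 0) : y = edgePoint E (∑ i, tangent E i * (y i - E.1 i)) := by
  have := F.tangent_sq_add_sq hE
  simp [normalCoord, normal, Fin.sum_univ_two] at hy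
  ext i
  fin_cases i
  · simp [edgePoint, Fin.sum_univ_two]
    linear_combination (-(y 0 - E.1 0)) * this - tangent E 1 * hy
  · simp [edgePoint, Fin.sum_univ_two]
    linear_combination (-(y 1 - E.1 1)) * this + tangent E 0 * hy

theorem edgePoint_ne_vertex (hE : E ∈ F.edges) {s : ℝ} (hs : s ∈ Set.Ioo 0 (edgeLength E)) :
    edgePoint E s ∉ ({E.1, E.2} : Set Plane) := by
  have := F.tangent_sq_add_sq hE
  have hinj : Function.Injective (edgePoint E) := fun a b hab => by
    have h0 := congrArg (fun y : Plane => y 0) hab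
    have h1 := congrArg (fun y : Plane => y 1) hab
    simp only [edgePoint, PiLp.add_apply, PiLp.smul_apply, smul_eq_mul] at h0 h1
    linear_combination (b - a) * this + tangent E 0 * h0 + tangent E 1 * h1
  rintro (h | h)
  · rw [← edgePoint_zero E] at h
    exact hs.1.ne' (hinj h)
  · rw [Set.mem_singleton_iff, ← F.edgePoint_edgeLength hE] at h
    exact hs.2.ne (hinj h)

/-- Near an interior point of an edge, the frontier is the line of that edge. -/
theorem eventually_mem_frontier_iff (hE : E ∈ F.edges) {s : ℝ}
    (hs : s ∈ Set.Ioo 0 (edgeLength E)) :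
    ∀ᶠ y in 𝓝 (edgePoint E s), y ∈ frontier F.carrier ↔ normalCoord E y = 0 := by
  have hT := F.tangent_sq_add_sq hE
  -- the other edges are closed and avoid the point
  have h1 : ∀ᶠ y in 𝓝 (edgePoint E s), ∀ E' ∈ F.edges, E' ≠ E → y ∉ segment ℝ E'.1 E'.2 := by
    refine (Filter.eventually_all_finset _).2 fun E' hE' => ?_
    by_cases hne : E' = E
    · simp [hne]
    · have hz : edgePoint E s ∉ segment ℝ E'.1 E'.2 := fun hz =>
        F.edgePoint_ne_vertex hE hs (F.segment_inter_subset E hE E' hE' (Ne.symm hne)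
          ⟨(F.mem_segment_iff hE _).2 ⟨s, Set.Ioo_subset_Icc_self hs, rfl⟩, hz⟩).1
      filter_upwards [(isClosed_segment _ _).isOpen_compl.mem_nhds hz] with y hy _ using hy
  have h2 : ∀ᶠ y in 𝓝 (edgePoint E s),
      (∑ i, tangent E i * (y i - E.1 i)) ∈ Set.Ioo 0 (edgeLength E) := by
    have hc : Continuous fun y : Plane => ∑ i, tangent E i * (y i - E.1 i) := by fun_prop
    refine hc.continuousAt.eventually_mem (isOpen_Ioo.mem_nhds ?_)
    have e : ∑ i, tangent E i * (edgePoint E s i - E.1 i) = s := by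
      simp [edgePoint, Fin.sum_univ_two]
      linear_combination s * hT
    rw [e]
    exact hs
  filter_upwards [h1, h2] with y hy1 hy2
  constructor
  · intro hy
    rw [← F.iUnion_segment] at hy
    obtain ⟨E', hE', hyE'⟩ := Set.mem_iUnion₂.1 hy
    have : E' = E := by
      by_contra hne
      exact hy1 E' hE' hne hyE'
    subst this
    obtain ⟨s', _, rfl⟩ := (F.mem_segment_iff hE' _).1 hyE'
    exact normalCoord_edgePoint _ _
  · intro hy
    rw [F.eq_edgePoint_of_normalCoord_eq_zero hE hy]
    exact F.edgePoint_mem_frontier hE (Set.Ioo_subset_Icc_self hy2)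

/-- Near an interior point of an edge, `F` is exactly one of the two sides of the edge: both are
connected and do not meet the frontier, and the direction of a Lipschitz chart points from the one
outside `F` to the one inside `F`. -/
theorem eventually_sides (hE : E ∈ F.edges) {s : ℝ} (hs : s ∈ Set.Ioo 0 (edgeLength E)) :
    (∀ᶠ y in 𝓝 (edgePoint E s),
      (0 < normalCoord E y → y ∈ F.carrier) ∧ (normalCoord E y < 0 → y ∉ F.carrier)) ∨
    ∀ᶠ y in 𝓝 (edgePoint E s),
      (normalCoord E y < 0 → y ∈ F.carrier) ∧ (0 < normalCoord E y → y ∉ F.carrier) := by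
  set z := edgePoint E s with hz
  obtain ⟨r, hr, hball⟩ := Metric.eventually_nhds_iff_ball.1 (F.eventually_mem_frontier_iff hE hs)
  have hzf : z ∈ frontier F.carrier := F.edgePoint_mem_frontier hE (Set.Ioo_subset_Icc_self hs)
  obtain ⟨e₁, e₂, -, h₂, h₁₂, φ, hchart⟩ :=
    F.isPolygon.hasLipschitzBoundary.exists_chart F.isOpen_carrier hzf
  have hzφ := hchart.self_of_nhds.2 hzf
  have hlim : ∀ c : ℝ, Tendsto (fun ε : ℝ => z + ε • c • e₂) (𝓝[>] 0) (𝓝 z) := fun c => by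
    have : Continuous fun ε : ℝ => z + ε • c • e₂ := by fun_prop
    simpa using (this.tendsto 0).mono_left nhdsWithin_le_nhds
  have hin : ∀ (c ε : ℝ), inner ℝ e₁ (z + ε • c • e₂) = inner ℝ e₁ z ∧
      inner ℝ e₂ (z + ε • c • e₂) = inner ℝ e₂ z + ε * c := fun c ε => by
    simp [inner_add_right, inner_smul_right, h₁₂, h₂]
  have hballz := Metric.isOpen_ball.mem_nhds (Metric.mem_ball_self (x := z) hr)
  obtain ⟨ε, hε1, hε2, hε3, hε4, hε⟩ := ((hlim 1).eventually hchart |>.and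
    ((hlim (-1)).eventually hchart |>.and (((hlim 1).eventually hballz).and
      (((hlim (-1)).eventually hballz).and self_mem_nhdsWithin)))).exists
  rw [(hin 1 ε).1, (hin 1 ε).2] at hε1
  rw [(hin (-1) ε).1, (hin (-1) ε).2] at hε2
  have hup : z + ε • (1 : ℝ) • e₂ ∈ F.carrier := hε1.1.2 (by linarith)
  have hdown : z + ε • (-1 : ℝ) • e₂ ∉ F.carrier := fun h => by linarith [hε2.1.1 h]
  have hside : ∀ c : ℝ, normalCoord E (z + ε • c • e₂) = ε * (c * ∑ i, normal E i * e₂ i) := by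
    intro c
    rw [normalCoord_add_smul, hz, normalCoord_edgePoint]
    simp [Fin.sum_univ_two]
    ring_nf
    simp
  set N := ∑ i, normal E i * e₂ i
  -- otherwise the chart direction would be tangent to `E`, and would not lead into `F`
  have hN : N ≠ 0 := by
    intro hN
    have hf := (hball _ hε3).2 (by rw [hside, hN]; ring)
    rw [F.isOpen_carrier.frontier_eq] at hf
    exact hf.2 hup
  have hpos := subset_or_disjoint_of_isPreconnected F.isOpen_carrier
    ((convex_ball z r).inter (convex_normalCoord_preimage E (convex_Ioi 0))).isPreconnected
    (Set.disjoint_left.2 fun y hy hyf => ((hball y hy.1).1 hyf).not_gt hy.2)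
  have hneg := subset_or_disjoint_of_isPreconnected F.isOpen_carrier
    ((convex_ball z r).inter (convex_normalCoord_preimage E (convex_Iio 0))).isPreconnected
    (Set.disjoint_left.2 fun y hy hyf => ((hball y hy.1).1 hyf).not_lt hy.2)
  rcases lt_or_gt_of_ne hN with hN | hN
  · have hupneg : normalCoord E (z + ε • (1 : ℝ) • e₂) < 0 := by
      rw [hside]; exact mul_neg_of_pos_of_neg hε (by linarith)
    have hdownpos : 0 < normalCoord E (z + ε • (-1 : ℝ) • e₂) := by
      rw [hside]; exact mul_pos hε (by linarith)
    have h1 := hneg.resolve_right fun h => Set.disjoint_left.1 h ⟨hε3, hupneg⟩ hup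
    have h2 := hpos.resolve_left fun h => hdown (h ⟨hε4, hdownpos⟩)
    right
    filter_upwards [hballz] with y hy
    exact ⟨fun h => h1 ⟨hy, h⟩, fun h => Set.disjoint_left.1 h2 ⟨hy, h⟩⟩
  · have huppos : 0 < normalCoord E (z + ε • (1 : ℝ) • e₂) := by
      rw [hside]; exact mul_pos hε (by linarith)
    have hdownneg : normalCoord E (z + ε • (-1 : ℝ) • e₂) < 0 := by
      rw [hside]; exact mul_neg_of_pos_of_neg hε (by linarith)
    have h1 := hpos.resolve_right fun h => Set.disjoint_left.1 h ⟨hε3, huppos⟩ hup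
    have h2 := hneg.resolve_left fun h => hdown (h ⟨hε4, hdownneg⟩)
    left
    filter_upwards [hballz] with y hy
    exact ⟨fun h => h1 ⟨hy, h⟩, fun h => Set.disjoint_left.1 h2 ⟨hy, h⟩⟩

/-- `ω_{FE} n_{FE}` points out of `F` all along `E`, not only at the midpoint. -/
theorem eventually_mem_of_normalCoord_mul_omega (hE : E ∈ F.edges) {s : ℝ}
    (hs : s ∈ Set.Ioo 0 (edgeLength E)) :
    ∀ᶠ y in 𝓝 (edgePoint E s), (normalCoord E y * F.omega E < 0 → y ∈ F.carrier) ∧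
      (0 < normalCoord E y * F.omega E → y ∉ F.carrier) := by
  -- `F` lies on the side of the normal near the point of parameter `s`; this does not depend on `s`,
  -- and `ω` is defined by it at the midpoint
  let P : ℝ → Prop := fun s =>
    ∀ᶠ ε : ℝ in 𝓝[>] 0, edgePoint E s + ε • normal E ∈ F.carrier
  have hlim : ∀ s : ℝ, Tendsto (fun ε : ℝ => edgePoint E s + ε • normal E) (𝓝[>] 0)
      (𝓝 (edgePoint E s)) := fun s => by
    have : Continuous fun ε : ℝ => edgePoint E s + ε • normal E := by fun_prop
    simpa using (this.tendsto 0).mono_left nhdsWithin_le_nhds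
  have hP1 : ∀ s, (∀ᶠ y in 𝓝 (edgePoint E s),
      (0 < normalCoord E y → y ∈ F.carrier) ∧ (normalCoord E y < 0 → y ∉ F.carrier)) → P s := by
    intro s h
    filter_upwards [(hlim s).eventually h, self_mem_nhdsWithin] with ε hε hε0
    exact hε.1 (by rw [F.normalCoord_edgePoint_add_normal hE]; exact hε0)
  have hP2 : ∀ s, (∀ᶠ y in 𝓝 (edgePoint E s),
      (normalCoord E y < 0 → y ∈ F.carrier) ∧ (0 < normalCoord E y → y ∉ F.carrier)) → ¬P s := by
    intro s h hPs
    obtain ⟨ε, hε1, hε2, hε3⟩ := (hPs.and (((hlim s).eventually h).and self_mem_nhdsWithin)).exists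
    exact hε2.2 (by rw [F.normalCoord_edgePoint_add_normal hE]; exact hε3) hε1
  have hloc : ∀ s ∈ Set.Ioo 0 (edgeLength E), ∀ᶠ s' in 𝓝[Set.Ioo 0 (edgeLength E)] s,
      (P s ↔ P s') ∧ (P s' ↔ P s) := by
    intro s hs
    have hc := (continuous_edgePoint E).continuousAt (x := s)
    rcases F.eventually_sides hE hs with h | h
    · filter_upwards [(hc.eventually (eventually_eventually_nhds.2 h)).filter_mono
        nhdsWithin_le_nhds] with s' hs'
      have h1 := hP1 s h
      have h2 := hP1 s' hs'
      tauto
    · filter_upwards [(hc.eventually (eventually_eventually_nhds.2 h)).filter_mono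
        nhdsWithin_le_nhds] with s' hs'
      have h1 := hP2 s h
      have h2 := hP2 s' hs'
      tauto
  have hL := F.edgeLength_pos hE
  have hmem : edgeLength E / 2 ∈ Set.Ioo 0 (edgeLength E) := ⟨by linarith, by linarith⟩
  have hPs : P s ↔ P (edgeLength E / 2) :=
    isPreconnected_Ioo.induction₂' (fun s s' => P s ↔ P s') hloc
      (fun _ _ _ _ _ _ h h' => h.trans h') hs hmem
  have hmid : midpoint ℝ E.1 E.2 = edgePoint E (edgeLength E / 2) := by
    ext i
    simp [midpoint_eq_smul_add, edgePoint, tangent]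
    field_simp
    ring
  classical
  have homega : F.omega E = if P s then -1 else 1 := by
    rw [omega, hmid]
    by_cases h : P s
    · rw [if_pos h, if_pos (hPs.1 h)]
    · rw [if_neg h, if_neg fun h' => h (hPs.2 h')]
  rcases F.eventually_sides hE hs with h | h
  · rw [homega, if_pos (hP1 s h)]
    filter_upwards [h] with y hy
    exact ⟨fun h => hy.1 (by linarith), fun h => hy.2 (by linarith)⟩
  · rw [homega, if_neg (hP2 s h)]
    filter_upwards [h] with y hy
    exact ⟨fun h => hy.1 (by linarith), fun h => hy.2 (by linarith)⟩

theorem omega_eq (E : Plane × Plane) : F.omega E = 1 ∨ F.omega E = -1 := by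
  unfold omega
  split_ifs
  · exact Or.inr rfl
  · exact Or.inl rfl

theorem omega_mul_self (E : Plane × Plane) : F.omega E * F.omega E = 1 := by
  rcases F.omega_eq E with h | h <;> rw [h] <;> norm_num

end OrientedPolygon

/-! ### Slicing the plane by coordinate lines -/

/-- The point whose `i`-th coordinate is `x` and whose other coordinate is `t`. -/
def slicePoint (i : Fin 2) (x t : ℝ) : Plane := WithLp.toLp 2 (Function.update (fun _ => t) i x)

theorem slicePoint_self (i : Fin 2) (x t : ℝ) : slicePoint i x t i = x := by simp [slicePoint]

theorem slicePoint_of_ne {i j : Fin 2} (h : j ≠ i) (x t : ℝ) : slicePoint i x t j = t := by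
  simp [slicePoint, h]

theorem eq_slicePoint {i j : Fin 2} (h : j ≠ i) (y : Plane) : y = slicePoint i (y i) (y j) := by
  ext k
  by_cases hk : k = i
  · rw [hk, slicePoint_self]
  · have : k = j := by omega
    rw [this, slicePoint_of_ne h]

theorem slicePoint_eq_add (i : Fin 2) (x x' t : ℝ) :
    slicePoint i x t = slicePoint i x' t + (x - x') • EuclideanSpace.single i 1 := by
  ext k
  by_cases hk : k = i
  · subst hk; simp [slicePoint]
  · simp [slicePoint, hk]

theorem continuous_slicePoint (i : Fin 2) (t : ℝ) : Continuous fun x => slicePoint i x t := by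
  have : (fun x => slicePoint i x t) =
      fun x => slicePoint i 0 t + (x - 0) • EuclideanSpace.single i 1 :=
    funext fun x => slicePoint_eq_add i x 0 t
  rw [this]
  fun_prop

theorem measurePreserving_slicePoint (i : Fin 2) :
    MeasurePreserving fun q : ℝ × ℝ => slicePoint i q.1 q.2 := by
  have h0 : MeasurePreserving fun q : ℝ × ℝ => (WithLp.toLp 2 ![q.1, q.2] : Plane) :=
    (EuclideanSpace.volume_preserving_symm_measurableEquiv_toLp (Fin 2)).symm.comp
      (volume_preserving_finTwoArrow ℝ).symm
  fin_cases i
  · convert h0 using 2 with q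
    ext k
    fin_cases k <;> simp [slicePoint]
  · convert h0.comp (Measure.measurePreserving_swap (μ := volume) (ν := volume)) using 2 with q
    ext k
    fin_cases k <;> simp [slicePoint]
    rfl

theorem integral_eq_integral_slices (i : Fin 2) {g : Plane → ℝ} (hg : Integrable g) :
    ∫ y, g y = ∫ t, ∫ x, g (slicePoint i x t) := by
  have hm := measurePreserving_slicePoint i
  have h1 : ∫ y, g y = ∫ q : ℝ × ℝ, g (slicePoint i q.1 q.2) := by
    rw [← hm.map_eq, integral_map hm.measurable.aemeasurable]
    rw [hm.map_eq]
    exact hg.aestronglyMeasurable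
  rw [h1]
  exact integral_prod_symm _ (hm.integrable_comp_of_integrable hg)

theorem hasDerivAt_eval_slicePoint (i : Fin 2) (t x : ℝ) (p : Poly2) :
    HasDerivAt (fun x => MvPolynomial.eval (fun k => slicePoint i x t k) p)
      (MvPolynomial.eval (fun k => slicePoint i x t k) (MvPolynomial.pderiv i p)) x := by
  induction p using MvPolynomial.induction_on with
  | C a => simpa using hasDerivAt_const x a
  | add p q hp hq => simp only [map_add]; exact hp.add hq
  | mul_X p k hp =>
    have hk : HasDerivAt (fun x => slicePoint i x t k)
        (MvPolynomial.eval (fun k => slicePoint i x t k)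
          (MvPolynomial.pderiv i (MvPolynomial.X k))) x := by
      by_cases h : k = i
      · subst h
        simpa [slicePoint] using hasDerivAt_id' x
      · simpa [slicePoint, h] using hasDerivAt_const x t
    simp only [MvPolynomial.pderiv_mul, map_add, map_mul, MvPolynomial.eval_X]
    exact hp.mul hk

namespace OrientedPolygon

variable (F : OrientedPolygon)

/-- The arclength parameter of the point of (the line of) `E` where the `j`-th coordinate is `t`. It
is `0`, a vertex, if this coordinate is constant on `E`. -/
def crossing (j : Fin 2) (E : Plane × Plane) (t : ℝ) : ℝ := (t - E.1 j) / tangent E j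

theorem edgePoint_crossing {j : Fin 2} {E : Plane × Plane} {t : ℝ}
    (h : crossing j E t ∈ Set.Ioo 0 (edgeLength E)) : edgePoint E (crossing j E t) j = t := by
  have hne : tangent E j ≠ 0 := fun h0 => by simp [crossing, h0] at h
  simp [edgePoint, crossing, hne]

theorem abs_normal {i j : Fin 2} (h : j ≠ i) (E : Plane × Plane) :
    |normal E i| = |tangent E j| := by
  fin_cases i <;> fin_cases j <;> simp_all [normal]

/-- A line parallel to the `i`-th axis that crosses `E` at an interior point enters `F` there if
`ω_{FE} n_{FE}` points backwards, and leaves it otherwise. -/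
theorem hasJump_slice {i j : Fin 2} (hij : j ≠ i) {E : Plane × Plane} (hE : E ∈ F.edges) {t : ℝ}
    (h : crossing j E t ∈ Set.Ioo 0 (edgeLength E)) :
    HasJump {x | slicePoint i x t ∈ F.carrier} (edgePoint E (crossing j E t) i)
      (-(F.omega E * Real.sign (normal E i))) := by
  set s := crossing j E t with hs
  have hz : edgePoint E s = slicePoint i (edgePoint E s i) t := by
    conv_lhs => rw [eq_slicePoint hij (edgePoint E s), edgePoint_crossing h]
  have hn : normal E i ≠ 0 := by
    rw [← abs_ne_zero, abs_normal hij, abs_ne_zero]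
    intro h0
    simp [hs, crossing, h0] at h
  have hd : ∀ x, normalCoord E (slicePoint i x t) =
      (x - edgePoint E s i) * normal E i := fun x => by
    rw [slicePoint_eq_add i x (edgePoint E s i), ← hz, normalCoord_add_smul, normalCoord_edgePoint]
    simp
  have hev := F.eventually_mem_of_normalCoord_mul_omega hE h
  rw [hz] at hev
  have hev' := (continuous_slicePoint i t).continuousAt.eventually hev
  simp only [hd] at hev'
  have hl := hev'.filter_mono (nhdsWithin_le_nhds (s := Set.Iio (edgePoint E s i)))
  have hr := hev'.filter_mono (nhdsWithin_le_nhds (s := Set.Ioi (edgePoint E s i)))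
  have hω := F.omega_eq E
  have hcases : (0 < normal E i * F.omega E ∧ -(F.omega E * Real.sign (normal E i)) = -1) ∨
      (normal E i * F.omega E < 0 ∧ -(F.omega E * Real.sign (normal E i)) = 1) := by
    rcases lt_or_gt_of_ne hn with hn | hn <;> rcases hω with hω | hω <;>
      simp [hω, Real.sign_of_neg, Real.sign_of_pos, hn]
  rcases hcases with ⟨hpos, hc⟩ | ⟨hneg, hc⟩
  · refine Or.inr ⟨hc, ?_, ?_⟩
    · filter_upwards [hl, self_mem_nhdsWithin] with x hx hlt
      refine hx.1 ?_
      rw [mul_assoc]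
      exact mul_neg_of_neg_of_pos (sub_neg.2 hlt) hpos
    · filter_upwards [hr, self_mem_nhdsWithin] with x hx hlt
      refine hx.2 ?_
      rw [mul_assoc]
      exact mul_pos (sub_pos.2 hlt) hpos
  · refine Or.inl ⟨hc, ?_, ?_⟩
    · filter_upwards [hl, self_mem_nhdsWithin] with x hx hlt
      refine hx.2 ?_
      rw [mul_assoc]
      exact mul_pos_of_neg_of_neg (sub_neg.2 hlt) hneg
    · filter_upwards [hr, self_mem_nhdsWithin] with x hx hlt
      refine hx.1 ?_
      rw [mul_assoc]
      exact mul_neg_of_pos_of_neg (sub_pos.2 hlt) hneg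

/-- A line that avoids the vertices crosses the frontier only at interior points of edges that are
transverse to it. -/
theorem exists_crossing {i j : Fin 2} (hij : j ≠ i) {t : ℝ}
    (ht : ∀ E ∈ F.edges, E.1 j ≠ t ∧ E.2 j ≠ t) {x : ℝ}
    (hx : slicePoint i x t ∈ frontier F.carrier) :
    ∃ E ∈ F.edges, crossing j E t ∈ Set.Ioo 0 (edgeLength E) ∧
      edgePoint E (crossing j E t) i = x := by
  rw [← F.iUnion_segment] at hx
  obtain ⟨E, hE, hx⟩ := Set.mem_iUnion₂.1 hx
  obtain ⟨s, hs, hxs⟩ := (F.mem_segment_iff hE _).1 hx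
  have hj : E.1 j + s * tangent E j = t := by
    have := congrArg (fun y : Plane => y j) hxs
    simp only [slicePoint_of_ne hij] at this
    simp [this, edgePoint]
  have hne : tangent E j ≠ 0 := fun h0 => (ht E hE).1 (by rw [← hj, h0, mul_zero, add_zero])
  have hsc : crossing j E t = s := by
    rw [crossing, ← hj]
    field_simp
    ring
  refine ⟨E, hE, ?_, by rw [hsc, ← hxs, slicePoint_self]⟩
  rw [hsc]
  refine ⟨lt_of_le_of_ne hs.1 fun h0 => ?_, lt_of_le_of_ne hs.2 fun hL => ?_⟩
  · exact (ht E hE).1 (by rw [← hj, ← h0, zero_mul, add_zero])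
  · refine (ht E hE).2 ?_
    rw [← F.edgePoint_edgeLength hE, ← hj, hL]
    simp [edgePoint]

/-- The fundamental theorem of calculus on a line parallel to a coordinate axis that avoids the
vertices. -/
theorem integral_slice {i j : Fin 2} (hij : j ≠ i) {t : ℝ}
    (ht : ∀ E ∈ F.edges, E.1 j ≠ t ∧ E.2 j ≠ t) (p : Poly2) :
    ∫ x in {x | slicePoint i x t ∈ F.carrier},
        MvPolynomial.eval (fun k => slicePoint i x t k) (MvPolynomial.pderiv i p) =
      ∑ E ∈ F.edges, F.omega E * (Real.sign (normal E i) *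
        (Set.Ioo 0 (edgeLength E)).indicator (fun s => (edgeTrace E p).eval s)
          (crossing j E t)) := by
  classical
  have hopen : IsOpen {x | slicePoint i x t ∈ F.carrier} :=
    F.isOpen_carrier.preimage (continuous_slicePoint i t)
  have hbdd : Bornology.IsBounded {x | slicePoint i x t ∈ F.carrier} := by
    have hc : Continuous fun y : Plane => y i := by fun_prop
    refine (F.isCompact_closure.image hc).isBounded.subset fun x hx => ?_
    exact ⟨_, subset_closure hx, slicePoint_self i x t⟩
  have hmem : ∀ E ∈ F.edges, crossing j E t ∈ Set.Ioo 0 (edgeLength E) →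
      edgePoint E (crossing j E t) = slicePoint i (edgePoint E (crossing j E t) i) t := by
    intro E hE h
    conv_lhs => rw [eq_slicePoint hij (edgePoint E _), edgePoint_crossing h]
  rw [setIntegral_deriv_eq_sum_jumps hbdd hopen.measurableSet
    (F.edges.filter fun E => crossing j E t ∈ Set.Ioo 0 (edgeLength E))
    (z := fun E => edgePoint E (crossing j E t) i)
    (c := fun E => -(F.omega E * Real.sign (normal E i))) ?_ ?_ ?_
    (fun x => hasDerivAt_eval_slicePoint i t x p)
    ((continuous_eval_poly _).comp (continuous_slicePoint i t))]
  · rw [Finset.sum_filter, ← Finset.sum_neg_distrib]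
    refine Finset.sum_congr rfl fun E hE => ?_
    split_ifs with h
    · rw [Set.indicator_of_mem h, eval_edgeTrace, ← hmem E hE h]
      ring
    · rw [Set.indicator_of_notMem h]
      simp
  · intro E hE E' hE' hz
    rw [Finset.mem_coe, Finset.mem_filter] at hE hE'
    simp only at hz
    by_contra hne
    have heq : edgePoint E (crossing j E t) = edgePoint E' (crossing j E' t) := by
      rw [hmem E hE.1 hE.2, hmem E' hE'.1 hE'.2, hz]
    refine F.edgePoint_ne_vertex hE.1 hE.2 (F.segment_inter_subset E hE.1 E' hE'.1 hne ⟨?_, ?_⟩).1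
    · exact (F.mem_segment_iff hE.1 _).2 ⟨_, Set.Ioo_subset_Icc_self hE.2, rfl⟩
    · exact (F.mem_segment_iff hE'.1 _).2 ⟨_, Set.Ioo_subset_Icc_self hE'.2, heq⟩
  · intro x hx
    have hxf : slicePoint i x t ∉ frontier F.carrier := fun hf => by
      obtain ⟨E, hE, h, hEx⟩ := F.exists_crossing hij ht hf
      exact hx E (Finset.mem_filter.2 ⟨hE, h⟩) hEx
    by_cases hxF : slicePoint i x t ∈ F.carrier
    · exact Or.inl (hopen.mem_nhds hxF)
    · right
      have hxc : slicePoint i x t ∈ (closure F.carrier)ᶜ := fun hc => hxf (by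
        rw [F.isOpen_carrier.frontier_eq]
        exact ⟨hc, hxF⟩)
      filter_upwards [(continuous_slicePoint i t).continuousAt.eventually_mem
        (isClosed_closure.isOpen_compl.mem_nhds hxc)] with y hy hyF using hy (subset_closure hyF)
  · intro E hE
    rw [Finset.mem_filter] at hE
    exact F.hasJump_slice hij hE.1 hE.2

/-! ### The divergence theorem -/

theorem sign_mul_abs_self (r : ℝ) : Real.sign r * |r| = r := by
  rcases lt_trichotomy r 0 with h | rfl | h
  · rw [Real.sign_of_neg h, abs_of_neg h]; ring
  · simp
  · rw [Real.sign_of_pos h, abs_of_pos h, one_mul]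

theorem integrable_indicator_edge (E : Plane × Plane) (p : Polynomial ℝ) :
    Integrable ((Set.Ioo 0 (edgeLength E)).indicator fun s => p.eval s) :=
  ((p.continuous.integrableOn_Icc).mono_set Set.Ioo_subset_Icc_self).integrable_indicator
    measurableSet_Ioo

theorem integrable_crossing (j : Fin 2) (E : Plane × Plane) (p : Polynomial ℝ) :
    Integrable fun t => (Set.Ioo 0 (edgeLength E)).indicator (fun s => p.eval s)
      (crossing j E t) := by
  by_cases h : tangent E j = 0
  · simp [crossing, h]
  · exact ((integrable_indicator_edge E p).comp_div h).comp_sub_right (E.1 j)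

/-- The change of variables from a coordinate to arclength on `E`; both sides are `0` if this
coordinate is constant on `E`. -/
theorem integral_crossing (j : Fin 2) {E : Plane × Plane} (hE : E ∈ F.edges) (p : Polynomial ℝ) :
    ∫ t, (Set.Ioo 0 (edgeLength E)).indicator (fun s => p.eval s) (crossing j E t) =
      |tangent E j| * edgeInt E p := by
  have h1 := integral_sub_right_eq_self (μ := volume) (fun t =>
    (Set.Ioo 0 (edgeLength E)).indicator (fun s => p.eval s) (t / tangent E j)) (E.1 j)
  have h2 := Measure.integral_comp_div
    ((Set.Ioo 0 (edgeLength E)).indicator fun s => p.eval s) (tangent E j)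
  have h3 : edgeInt E p = ∫ s in (0 : ℝ)..edgeLength E, p.eval s := rfl
  rw [h3, intervalIntegral.integral_of_le (F.edgeLength_pos hE).le, integral_Ioc_eq_integral_Ioo,
    ← integral_indicator measurableSet_Ioo, ← smul_eq_mul, ← h2, ← h1]
  rfl

/-- The divergence theorem for a field parallel to the `i`-th axis, by integration over the lines
with this direction. The lines that pass through a vertex are negligible. -/
theorem faceInt_pderiv (i : Fin 2) (p : Poly2) :
    F.faceInt (MvPolynomial.pderiv i p) =
      ∑ E ∈ F.edges, F.omega E * (normal E i * edgeInt E (edgeTrace E p)) := by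
  obtain ⟨j, hij⟩ : ∃ j : Fin 2, j ≠ i := exists_ne i
  set f : Plane → ℝ := fun y => MvPolynomial.eval (fun k => y k) (MvPolynomial.pderiv i p) with hf
  have hint : Integrable (F.carrier.indicator f) :=
    (F.integrableOn_of_continuousOn
      (continuous_eval_poly _).continuousOn).integrable_indicator F.isOpen_carrier.measurableSet
  have hnull : ∀ᵐ t : ℝ, ∀ E ∈ F.edges, E.1 j ≠ t ∧ E.2 j ≠ t := by
    refine (Filter.eventually_all_finset _).2 fun E _ => ?_
    have h : ∀ a : ℝ, ∀ᵐ t : ℝ, a ≠ t := fun a => by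
      filter_upwards [compl_mem_ae_iff.2 (measure_singleton a)] with t ht h using ht h.symm
    exact (h _).and (h _)
  have h1 : F.faceInt (MvPolynomial.pderiv i p) = ∫ y, F.carrier.indicator f y :=
    (integral_indicator F.isOpen_carrier.measurableSet).symm
  have h2 : ∀ᵐ t : ℝ, ∫ x, F.carrier.indicator f (slicePoint i x t) =
      ∑ E ∈ F.edges, F.omega E * (Real.sign (normal E i) *
        (Set.Ioo 0 (edgeLength E)).indicator (fun s => (edgeTrace E p).eval s)
          (crossing j E t)) := by
    filter_upwards [hnull] with t ht
    have hm : MeasurableSet {x | slicePoint i x t ∈ F.carrier} :=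
      (F.isOpen_carrier.preimage (continuous_slicePoint i t)).measurableSet
    rw [← F.integral_slice hij ht, ← integral_indicator hm]
    rfl
  rw [h1, integral_eq_integral_slices i hint, integral_congr_ae h2, integral_finsetSum _
    fun E _ => ((integrable_crossing j E _).const_mul _).const_mul _]
  refine Finset.sum_congr rfl fun E hE => ?_
  rw [integral_const_mul, integral_const_mul, F.integral_crossing j hE, ← abs_normal hij,
    ← mul_assoc (Real.sign _), sign_mul_abs_self]

/-- The divergence theorem for polynomial vector fields on a polygon. -/
theorem faceInt_divergence (w : VPoly2) :
    F.faceInt (divergence w) = ∑ E : F.edges, F.omega E * edgeInt E (normalTrace E w) := by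
  rw [divergence_apply, map_add, faceInt_pderiv, faceInt_pderiv, ← Finset.sum_add_distrib,
    Finset.sum_coe_sort F.edges fun E => F.omega E * edgeInt E (normalTrace E w)]
  refine Finset.sum_congr rfl fun E _ => ?_
  rw [normalTrace_apply, Fin.sum_univ_two, map_add, map_smul, map_smul, smul_eq_mul, smul_eq_mul,
    mul_add]

end OrientedPolygon

/-! ### The boundary is a cycle -/

/-- Lagrange interpolation in the plane. -/
theorem exists_eval_eq (S : Finset Plane) (f : Plane → ℝ) :
    ∃ p : Poly2, ∀ v ∈ S, MvPolynomial.eval (fun i => v i) p = f v := by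
  classical
  -- the product of the squared distances to the points of `S` other than `v`
  let b : Plane → Poly2 := fun v =>
    ∏ x ∈ S.erase v, ∑ i, (MvPolynomial.X i - MvPolynomial.C (x i)) ^ 2
  have hb : ∀ v w : Plane, MvPolynomial.eval (fun i => w i) (b v) =
      ∏ x ∈ S.erase v, ∑ i, (w i - x i) ^ 2 := fun v w => by
    simp only [b, map_prod, map_sum, map_pow, map_sub, MvPolynomial.eval_X, MvPolynomial.eval_C]
  have hself : ∀ v, MvPolynomial.eval (fun i => v i) (b v) ≠ 0 := fun v => by
    rw [hb, Finset.prod_ne_zero_iff]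
    intro x hx h0
    rw [Finset.sum_eq_zero_iff_of_nonneg fun i _ => sq_nonneg _] at h0
    refine (Finset.ne_of_mem_erase hx) (PiLp.ext fun i => ?_)
    have := h0 i (Finset.mem_univ i)
    exact (sub_eq_zero.1 (pow_eq_zero_iff two_ne_zero |>.1 this)).symm
  have hother : ∀ v, ∀ w ∈ S, w ≠ v → MvPolynomial.eval (fun i => w i) (b v) = 0 := by
    intro v w hw hne
    rw [hb]
    exact Finset.prod_eq_zero (Finset.mem_erase.2 ⟨hne, hw⟩) (by simp)
  refine ⟨∑ v ∈ S, MvPolynomial.C (f v / MvPolynomial.eval (fun i => v i) (b v)) * b v,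
    fun v hv => ?_⟩
  rw [map_sum, Finset.sum_eq_single_of_mem v hv]
  · rw [map_mul, MvPolynomial.eval_C, div_mul_cancel₀ _ (hself v)]
  · intro w _ hne
    rw [map_mul, hother w v hv hne.symm, mul_zero]

namespace OrientedPolygon

variable (F : OrientedPolygon)

/-- The edges, weighted by `ω_{FE}`, form a cycle. This is the divergence theorem for the
divergence-free field `rot p`, where the polynomial `p` coincides with `f` at the vertices. -/
theorem sum_omega_mul_sub (f : Plane → ℝ) :
    ∑ E : F.edges, F.omega E * (f (E : Plane × Plane).2 - f (E : Plane × Plane).1) = 0 := by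
  classical
  obtain ⟨p, hp⟩ := exists_eval_eq (F.edges.image Prod.fst ∪ F.edges.image Prod.snd) f
  have h := F.faceInt_divergence (vrot p)
  rw [divergence_vrot, map_zero] at h
  rw [← neg_eq_zero, ← Finset.sum_neg_distrib, h]
  refine Finset.sum_congr rfl fun E _ => ?_
  rw [normalTrace_vrot, map_neg, edgeInt_derivative, eval_edgeTrace, eval_edgeTrace,
    F.edgePoint_edgeLength E.2, edgePoint_zero, hp _ (Finset.mem_union_right _
      (Finset.mem_image_of_mem _ E.2)), hp _ (Finset.mem_union_left _
      (Finset.mem_image_of_mem _ E.2)), mul_neg]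

/-! ### Every cycle is a multiple of the boundary cycle -/

theorem exists_other_vertex {E : Plane × Plane} (hE : E ∈ F.edges) {v : Plane}
    (hv : v = E.1 ∨ v = E.2) : ∃ w, w ≠ v ∧ segment ℝ v w = segment ℝ E.1 E.2 ∧
      ({E.1, E.2} : Set Plane) = {v, w} := by
  rcases hv with rfl | rfl
  · exact ⟨E.2, (F.fst_ne_snd E hE).symm, rfl, rfl⟩
  · exact ⟨E.1, F.fst_ne_snd E hE, segment_symm _ _ _, Set.pair_comm _ _⟩

/-- At most two edges meet at a vertex: in a Lipschitz chart they leave the vertex in different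
horizontal directions. -/
theorem eq_or_eq_of_common_vertex {E E' E'' : Plane × Plane} (hE : E ∈ F.edges)
    (hE' : E' ∈ F.edges) (hE'' : E'' ∈ F.edges) {v : Plane} (hv : v = E.1 ∨ v = E.2)
    (hv' : v = E'.1 ∨ v = E'.2) (hv'' : v = E''.1 ∨ v = E''.2) :
    E = E' ∨ E = E'' ∨ E' = E'' := by
  have hvf : v ∈ frontier F.carrier := by
    rw [← F.iUnion_segment]
    refine Set.mem_biUnion hE ?_
    rcases hv with rfl | rfl
    · exact left_mem_segment _ _ _
    · exact right_mem_segment _ _ _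
  obtain ⟨e₁, e₂, h₁, h₂, h₁₂, φ, hchart⟩ :=
    F.isPolygon.hasLipschitzBoundary.exists_chart F.isOpen_carrier hvf
  have hlim : ∀ d : Plane, Tendsto (fun ε : ℝ => v + ε • d) (𝓝[>] 0) (𝓝 v) := fun d => by
    have : Continuous fun ε : ℝ => v + ε • d := by fun_prop
    simpa using (this.tendsto 0).mono_left nhdsWithin_le_nhds
  have hmem : ∀ (w : Plane) (ε : ℝ), 0 < ε → ε < 1 → v + ε • (w - v) ∈ segment ℝ v w :=
    fun w ε h0 h1 => by
      rw [segment_eq_image']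
      exact ⟨ε, ⟨h0.le, h1.le⟩, rfl⟩
  have hlt : ∀ c : ℝ, ∀ᶠ ε : ℝ in 𝓝[>] 0, ε * c < 1 := fun c => by
    have hc : Continuous fun ε : ℝ => ε * c := by fun_prop
    refine (hc.continuousAt.eventually_lt continuousAt_const ?_).filter_mono nhdsWithin_le_nhds
    simp
  have hseg : ∀ D ∈ F.edges, ∀ w, segment ℝ v w = segment ℝ D.1 D.2 →
      ∀ y ∈ segment ℝ v w, y ∈ frontier F.carrier := fun D hD w hw y hy => by
    rw [← F.iUnion_segment]
    exact Set.mem_biUnion hD (hw ▸ hy)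
  -- no edge is vertical in the chart
  have hne : ∀ D ∈ F.edges, ∀ w, w ≠ v → segment ℝ v w = segment ℝ D.1 D.2 →
      inner ℝ e₁ (w - v) ≠ 0 := by
    intro D hD w hw hs h0
    obtain ⟨ε, hε, hε1, hε0⟩ := ((((hlim (w - v)).eventually hchart)).and
      ((hlt 1).and self_mem_nhdsWithin)).exists
    replace hε0 : 0 < ε := hε0
    have hy := hε.2 (hseg D hD w hs _ (hmem w ε hε0 (by linarith)))
    have hin : inner ℝ e₁ (v + ε • (w - v)) = inner ℝ e₁ v := by
      rw [inner_add_right, inner_smul_right, h0, mul_zero, add_zero]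
    have heq := eq_of_inner_eq h₁ h₂ h₁₂ hin
      (by rw [hy, hin, hchart.self_of_nhds.2 hvf])
    rw [add_eq_left, smul_eq_zero] at heq
    exact heq.elim hε0.ne' (sub_ne_zero.2 hw)
  -- two edges that leave in the same direction have another point in common
  have hsame : ∀ D ∈ F.edges, ∀ D' ∈ F.edges, ∀ w w', w ≠ v → w' ≠ v →
      segment ℝ v w = segment ℝ D.1 D.2 → segment ℝ v w' = segment ℝ D'.1 D'.2 →
      ({D.1, D.2} : Set Plane) = {v, w} →
      0 < inner ℝ e₁ (w - v) * inner ℝ e₁ (w' - v) → D = D' := by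
    intro D hD D' hD' w w' hw hw' hs hs' hp hpos
    by_contra hDD'
    set a := inner ℝ e₁ (w - v) with ha
    set a' := inner ℝ e₁ (w' - v) with ha'
    have ha0 : a ≠ 0 := left_ne_zero_of_mul hpos.ne'
    have ha0' : a' ≠ 0 := right_ne_zero_of_mul hpos.ne'
    obtain ⟨ε, hε1, hε2, hε3, hε4, hε0⟩ := (((hlim (|a'| • (w - v))).eventually hchart).and
      (((hlim (|a| • (w' - v))).eventually hchart).and
      ((hlt |a'|).and ((hlt |a|).and self_mem_nhdsWithin)))).exists
    replace hε0 : 0 < ε := hε0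
    rw [smul_smul] at hε1 hε2
    have hp1 : 0 < ε * |a'| := mul_pos hε0 (abs_pos.2 ha0')
    have hp2 : 0 < ε * |a| := mul_pos hε0 (abs_pos.2 ha0)
    have hy := hmem w _ hp1 hε3
    have hy' := hmem w' _ hp2 hε4
    have hf := hε1.2 (hseg D hD w hs _ hy)
    have hf' := hε2.2 (hseg D' hD' w' hs' _ hy')
    have habs : |a'| * a = |a| * a' := by
      rcases pos_and_pos_or_neg_and_neg_of_mul_pos hpos with ⟨h, h'⟩ | ⟨h, h'⟩
      · rw [abs_of_pos h, abs_of_pos h']; ring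
      · rw [abs_of_neg h, abs_of_neg h']; ring
    have hin : inner ℝ e₁ (v + (ε * |a'|) • (w - v)) = inner ℝ e₁ (v + (ε * |a|) • (w' - v)) := by
      rw [inner_add_right, inner_smul_right, inner_add_right, inner_smul_right, ← ha, ← ha',
        mul_assoc, mul_assoc, habs]
    have heq := eq_of_inner_eq h₁ h₂ h₁₂ hin (by rw [hf, hf', hin])
    have hvert := (F.segment_inter_subset D hD D' hD' hDD'
      ⟨hs ▸ hy, hs' ▸ heq ▸ hy'⟩).1
    rw [hp] at hvert
    rcases hvert with h | h
    · rw [add_eq_left, smul_eq_zero] at h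
      exact h.elim hp1.ne' (sub_ne_zero.2 hw)
    · have h' : (1 - ε * |a'|) • (w - v) = 0 := by
        rw [Set.mem_singleton_iff, ← eq_sub_iff_add_eq'] at h
        rw [sub_smul, one_smul, h, sub_self]
      rw [smul_eq_zero] at h'
      exact h'.elim (fun h => by linarith) (sub_ne_zero.2 hw)
  obtain ⟨w, hw, hs, hp⟩ := F.exists_other_vertex hE hv
  obtain ⟨w', hw', hs', hp'⟩ := F.exists_other_vertex hE' hv'
  obtain ⟨w'', hw'', hs'', hp''⟩ := F.exists_other_vertex hE'' hv''
  have ha := hne E hE w hw hs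
  have ha' := hne E' hE' w' hw' hs'
  have ha'' := hne E'' hE'' w'' hw'' hs''
  by_cases c1 : 0 < inner ℝ e₁ (w - v) * inner ℝ e₁ (w' - v)
  · exact Or.inl (hsame E hE E' hE' w w' hw hw' hs hs' hp c1)
  by_cases c2 : 0 < inner ℝ e₁ (w - v) * inner ℝ e₁ (w'' - v)
  · exact Or.inr (Or.inl (hsame E hE E'' hE'' w w'' hw hw'' hs hs'' hp c2))
  -- if neither `E'` nor `E''` leaves in the direction of `E`, both leave in the opposite one
  refine Or.inr (Or.inr (hsame E' hE' E'' hE'' w' w'' hw' hw'' hs' hs'' hp' ?_))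
  have h1 := lt_of_le_of_ne (not_lt.1 c1) (mul_ne_zero ha ha')
  have h2 := lt_of_le_of_ne (not_lt.1 c2) (mul_ne_zero ha ha'')
  refine (mul_pos_iff_of_pos_left (mul_self_pos.2 ha)).1 ?_
  linarith [mul_pos_of_neg_of_neg h1 h2]

theorem edges_nonempty : F.edges.Nonempty := by
  obtain ⟨x, hx⟩ := F.isPolygon.isConnected_frontier.nonempty
  rw [← F.iUnion_segment] at hx
  obtain ⟨E, hE, _⟩ := Set.mem_iUnion₂.1 hx
  exact ⟨E, hE⟩

/-- `c` is a cycle: at each vertex, the sum of the coefficients of the incoming edges is the sum of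
those of the outgoing edges. -/
def IsCycle (c : F.edges → ℝ) : Prop :=
  ∀ f : Plane → ℝ, ∑ E, c E * (f (E : Plane × Plane).2 - f (E : Plane × Plane).1) = 0

/-- Since at most two edges meet at a vertex, the vanishing of a cycle propagates from one to the
other. -/
theorem IsCycle.eq_zero_of_common_vertex {c : F.edges → ℝ} (hc : F.IsCycle c) {E E' : F.edges}
    (h0 : c E = 0) {v : Plane} (hv : v = (E : Plane × Plane).1 ∨ v = (E : Plane × Plane).2)
    (hv' : v = (E' : Plane × Plane).1 ∨ v = (E' : Plane × Plane).2) : c E' = 0 := by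
  classical
  by_cases hEE' : E = E'
  · rw [← hEE', h0]
  have h := hc (Pi.single v 1)
  rw [Finset.sum_eq_single E'] at h
  · refine (mul_eq_zero.1 h).resolve_right ?_
    have hne := F.fst_ne_snd _ E'.2
    rcases hv' with rfl | rfl
    · simp [hne.symm]
    · simp [hne]
  · intro D _ hD
    by_cases hDE : D = E
    · rw [hDE, h0, zero_mul]
    · have h1 : (D : Plane × Plane).1 ≠ v ∧ (D : Plane × Plane).2 ≠ v := by
        rw [← not_or]
        intro hor
        have hvD : v = (D : Plane × Plane).1 ∨ v = (D : Plane × Plane).2 :=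
          hor.imp Eq.symm Eq.symm
        rcases F.eq_or_eq_of_common_vertex E.2 E'.2 D.2 hv hv' hvD with h | h | h
        · exact hEE' (Subtype.ext h)
        · exact hDE (Subtype.ext h.symm)
        · exact hD (Subtype.ext h.symm)
      simp [h1.1, h1.2]
  · exact fun h => absurd (Finset.mem_univ _) h

/-- A cycle that vanishes on one edge vanishes on all edges, since the boundary is connected. -/
theorem IsCycle.eq_zero {c : F.edges → ℝ} (hc : F.IsCycle c) {E₀ : F.edges} (h0 : c E₀ = 0)
    (E : F.edges) : c E = 0 := by
  by_contra hE
  let S : Set F.edges → Set Plane := fun A =>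
    ⋃ D ∈ A, segment ℝ (D : Plane × Plane).1 (D : Plane × Plane).2
  have hS : ∀ A, IsClosed (S A) := fun A =>
    A.toFinite.isClosed_biUnion fun D _ => isClosed_segment _ _
  have hcov : frontier F.carrier ⊆ S {D | c D = 0} ∪ S {D | c D ≠ 0} := by
    intro x hx
    rw [← F.iUnion_segment] at hx
    obtain ⟨D, hD, hxD⟩ := Set.mem_iUnion₂.1 hx
    by_cases h : c ⟨D, hD⟩ = 0
    · exact Or.inl (Set.mem_biUnion (x := ⟨D, hD⟩) h hxD)
    · exact Or.inr (Set.mem_biUnion (x := ⟨D, hD⟩) h hxD)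
  have hmem : ∀ D : F.edges, (D : Plane × Plane).1 ∈ frontier F.carrier := fun D => by
    rw [← F.iUnion_segment]
    exact Set.mem_biUnion D.2 (left_mem_segment _ _ _)
  obtain ⟨x, -, hx, hx'⟩ := isPreconnected_closed_iff.1
    F.isPolygon.isConnected_frontier.isPreconnected _ _ (hS _) (hS _) hcov
    ⟨_, hmem E₀, Set.mem_biUnion (x := E₀) h0 (left_mem_segment _ _ _)⟩
    ⟨_, hmem E, Set.mem_biUnion (x := E) hE (left_mem_segment _ _ _)⟩
  obtain ⟨D, hD, hxD⟩ := Set.mem_iUnion₂.1 hx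
  obtain ⟨D', hD', hxD'⟩ := Set.mem_iUnion₂.1 hx'
  have hne : (D : Plane × Plane) ≠ D' := fun h => hD' (by rw [← Subtype.ext h]; exact hD)
  have hv := F.segment_inter_subset D D.2 D' D'.2 hne ⟨hxD, hxD'⟩
  exact hD' (hc.eq_zero_of_common_vertex F hD hv.1 hv.2)

theorem IsCycle.exists_eq_mul_omega {c : F.edges → ℝ} (hc : F.IsCycle c) :
    ∃ a : ℝ, ∀ E, c E = a * F.omega E := by
  obtain ⟨E₀, hE₀⟩ := F.edges_nonempty
  set a := c ⟨E₀, hE₀⟩ * F.omega E₀ with ha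
  have hcyc : F.IsCycle fun E => c E - a * F.omega E := fun f => by
    simp only [sub_mul, Finset.sum_sub_distrib, mul_assoc, ← Finset.mul_sum]
    rw [hc f, F.sum_omega_mul_sub f, mul_zero, sub_zero]
  refine ⟨a, fun E => sub_eq_zero.1 (hcyc.eq_zero F (E₀ := ⟨E₀, hE₀⟩) ?_ E)⟩
  simp only [ha]
  linear_combination -c ⟨E₀, hE₀⟩ * F.omega_mul_self E₀

/-- A family of increments along the edges comes from a function at the vertices as soon as its sum
along the boundary cycle is zero, since this is the only cycle up to a factor. -/
theorem exists_potential {b : F.edges → ℝ} (hb : ∑ E : F.edges, F.omega E * b E = 0) :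
    ∃ f : Plane → ℝ, ∀ E : F.edges, f (E : Plane × Plane).2 - f (E : Plane × Plane).1 = b E := by
  classical
  let δ : (Plane → ℝ) →ₗ[ℝ] (F.edges → ℝ) :=
    LinearMap.pi fun E => (LinearMap.proj (E : Plane × Plane).2 : (Plane → ℝ) →ₗ[ℝ] ℝ) -
      LinearMap.proj (E : Plane × Plane).1
  suffices h : b ∈ LinearMap.range δ by
    obtain ⟨f, hf⟩ := h
    exact ⟨f, fun E => congrFun hf E⟩
  by_contra hbr
  obtain ⟨ψ, hψ, hker⟩ := Submodule.exists_le_ker_of_notMem hbr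
  let c : F.edges → ℝ := fun E => ψ fun E' => if E = E' then 1 else 0
  have hψs : ∀ u : F.edges → ℝ, ψ u = ∑ E, c E * u E := fun u => by
    rw [ψ.pi_apply_eq_sum_univ]
    exact Finset.sum_congr rfl fun E _ => mul_comm _ _
  have hcyc : F.IsCycle c := fun f => by
    have h : ψ (δ f) = 0 := hker ⟨f, rfl⟩
    rw [hψs] at h
    exact h
  obtain ⟨a, ha⟩ := hcyc.exists_eq_mul_omega
  refine hψ ?_
  rw [hψs]
  simp only [ha, mul_assoc, ← Finset.mul_sum]
  rw [hb, mul_zero]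

/-- A continuous function on the boundary whose derivative vanishes on each edge is constant: it
takes finitely many values on a connected set. -/
theorem exists_eq_const_of_derivative_eq_zero {ℓ : ℤ} (q : F.BdryPolyC ℓ)
    (hq : ∀ E, Polynomial.derivative (F.restrictEdges ℓ q E : Polynomial ℝ) = 0) :
    ∃ a : ℝ, ∀ x, (q : C(frontier F.carrier, ℝ)) x = a := by
  have hE : ∀ E, ∃ a : ℝ, (F.restrictEdges ℓ q E : Polynomial ℝ) = Polynomial.C a := fun E =>
    ⟨_, Polynomial.eq_C_of_derivative_eq_zero (hq E)⟩
  choose a ha using hE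
  have hsub : Set.range (q : C(frontier F.carrier, ℝ)) ⊆ Set.range a := by
    rintro _ ⟨x, rfl⟩
    have hx : (x : Plane) ∈ ⋃ E ∈ F.edges, segment ℝ E.1 E.2 := by
      rw [F.iUnion_segment]; exact x.2
    obtain ⟨E, hE, hxE⟩ := Set.mem_iUnion₂.1 hx
    obtain ⟨s, hs, hxs⟩ := (F.mem_segment_iff hE _).1 hxE
    refine ⟨⟨E, hE⟩, ?_⟩
    rw [F.restrictEdges_spec ℓ q ⟨E, hE⟩ x s hs hxs, ha, Polynomial.eval_C]
  have : ConnectedSpace (frontier F.carrier) :=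
    isConnected_iff_connectedSpace.1 F.isPolygon.isConnected_frontier
  have hss := ((Set.finite_range a).subset hsub).countable.isTotallyDisconnected _ subset_rfl
    (isPreconnected_range (q : C(frontier F.carrier, ℝ)).continuous)
  obtain ⟨x₀⟩ := (inferInstance : Nonempty (frontier F.carrier))
  exact ⟨(q : C(frontier F.carrier, ℝ)) x₀, fun x => hss ⟨x, rfl⟩ ⟨x₀, rfl⟩⟩

end OrientedPolygon

/-! ### Polynomials on an edge -/

theorem C_mem_edgePoly {ℓ : ℤ} (hℓ : 0 ≤ ℓ) (a : ℝ) : Polynomial.C a ∈ EdgePoly ℓ := by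
  intro n hn
  rw [Polynomial.coeff_C, if_neg (by omega)]

theorem exists_edge_primitive {ℓ : ℤ} (hℓ : 0 ≤ ℓ) {p : Polynomial ℝ} (hp : p ∈ EdgePoly ℓ)
    (a : ℝ) : ∃ P ∈ EdgePoly (ℓ + 1), Polynomial.derivative P = p ∧ P.eval 0 = a := by
  let Q : Polynomial ℝ := p.sum fun n c => Polynomial.C (c / (n + 1)) * Polynomial.X ^ (n + 1)
  have hQ : Q ∈ EdgePoly (ℓ + 1) := by
    refine sum_mem fun n hn => ?_
    intro m hm
    rw [Polynomial.coeff_C_mul_X_pow, if_neg]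
    rintro rfl
    refine Polynomial.mem_support_iff.1 hn (hp n ?_)
    push_cast at hm
    omega
  have hQ' : Polynomial.derivative Q = p := by
    simp only [Q, Polynomial.sum, Polynomial.derivative_sum, Polynomial.derivative_C_mul_X_pow]
    conv_rhs => rw [← Polynomial.sum_C_mul_X_pow_eq p, Polynomial.sum]
    refine Finset.sum_congr rfl fun n _ => ?_
    have : (n : ℝ) + 1 ≠ 0 := by positivity
    simp [this]
  refine ⟨Q - Polynomial.C (Q.eval 0) + Polynomial.C a,
    add_mem (sub_mem hQ (C_mem_edgePoly (by omega) _)) (C_mem_edgePoly (by omega) _), ?_, ?_⟩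
  · simp [hQ']
  · simp

namespace OrientedPolygon

variable (F : OrientedPolygon)

/-! ### Orthogonality -/

theorem l2_comm (p q : Poly2) : F.l2 p q = F.l2 q p :=
  congrArg F.faceInt (mul_comm p q)

theorem vl2_apply (v w : VPoly2) : F.vl2 v w = F.l2 (v 0) (w 0) + F.l2 (v 1) (w 1) := by
  simp [vl2, Fin.sum_univ_two]

theorem vl2_comm (v w : VPoly2) : F.vl2 v w = F.vl2 w v := by
  rw [vl2_apply, vl2_apply, F.l2_comm (v 0), F.l2_comm (v 1)]

theorem vl2_vproj (V : Submodule ℝ VPoly2) [FiniteDimensional ℝ V] (v : VPoly2) {w : VPoly2}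
    (hw : w ∈ V) : F.vl2 (F.vproj V v) w = F.vl2 v w :=
  riesz_spec F.vl2 F.vl2_definite V _ ⟨w, hw⟩

theorem vl2_eq_zero_of_mem {ℓ : ℤ} {v w : VPoly2} (hv : v ∈ Roly ℓ) (hw : w ∈ F.RolyPerp ℓ) :
    F.vl2 v w = 0 := hw.2 v hv

theorem divergence_eq_zero_of_mem_Roly {ℓ : ℤ} {w : VPoly2} (hw : w ∈ Roly ℓ) :
    divergence w = 0 := by
  obtain ⟨p, _, rfl⟩ := hw
  exact divergence_vrot p

theorem eq_zero_of_mem_RolyPerp {ℓ : ℤ} {w : VPoly2} (hw : w ∈ F.RolyPerp ℓ)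
    (h : divergence w = 0) : w = 0 :=
  F.vl2_definite w (F.vl2_eq_zero_of_mem (mem_Roly_of_divergence_eq_zero hw.1 h) hw)

theorem exists_mem_RolyPerp {ℓ : ℤ} {p : Poly2} (hp : p ∈ Poly (ℓ - 1)) :
    ∃ w ∈ F.RolyPerp ℓ, divergence w = p := by
  obtain ⟨w, hw, rfl⟩ := exists_divergence_eq hp
  refine ⟨w - F.vproj (Roly ℓ) w, ⟨sub_mem hw (Roly_le_VPoly ℓ (F.vproj (Roly ℓ) w).2), ?_⟩, ?_⟩
  · intro v hv
    change F.vl2 v _ = 0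
    rw [map_sub, F.vl2_comm v (F.vproj (Roly ℓ) w), F.vl2_vproj _ _ hv, F.vl2_comm v, sub_self]
  · rw [map_sub, divergence_eq_zero_of_mem_Roly (F.vproj (Roly ℓ) w).2, sub_zero]

/-- The divergence is an isomorphism from `R_ℓ(F)^⊥` onto `P_{ℓ-1}(F)`. -/
def divergenceEquiv (ℓ : ℤ) : F.RolyPerp ℓ ≃ₗ[ℝ] Poly (ℓ - 1) :=
  LinearEquiv.ofBijective
    (divergence.restrict fun _ hw => divergence_mem_Poly hw.1 :
      F.RolyPerp ℓ →ₗ[ℝ] Poly (ℓ - 1)) <| by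
    constructor
    · rw [← LinearMap.ker_eq_bot, LinearMap.ker_eq_bot']
      intro w hw
      exact Subtype.ext (F.eq_zero_of_mem_RolyPerp w.2 (congrArg Subtype.val hw))
    · rintro ⟨p, hp⟩
      obtain ⟨w, hw, rfl⟩ := F.exists_mem_RolyPerp hp
      exact ⟨⟨w, hw⟩, rfl⟩

/-! ### The discrete gradient and curl, tested against fields -/

/-- The right-hand side of the equation that defines the full gradient. -/
def gradientForm (k : ℕ) (q : F.XGrad k) (w : VPoly2) : ℝ :=
  -F.faceInt (q.1 * divergence w) + ∑ E : F.edges, F.omega E *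
    edgeInt E ((F.restrictEdges _ q.2 E : Polynomial ℝ) * normalTrace E w)

theorem discreteGradient_fst (k : ℕ) (q : F.XGrad k) :
    ((F.discreteGradient k q).1 : VPoly2) =
      F.vproj (Roly ((k : ℤ) - 1)) (F.fullGradient k q) +
        F.vproj (F.RolyPerp (k : ℤ)) (F.fullGradient k q) := rfl

theorem vl2_discreteGradient_of_mem_Roly (k : ℕ) (q : F.XGrad k) {w : VPoly2}
    (hw : w ∈ Roly ((k : ℤ) - 1)) :
    F.vl2 (F.discreteGradient k q).1 w = F.gradientForm k q w := by
  have hw' : w ∈ Roly (k : ℤ) := Roly_mono (by omega) hw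
  rw [discreteGradient_fst, map_add, LinearMap.add_apply, F.vl2_vproj _ _ hw, F.vl2_comm _ w,
    F.vl2_comm _ w, F.vl2_eq_zero_of_mem hw' (F.vproj (F.RolyPerp (k : ℤ)) _).2, add_zero,
    F.vl2_comm w, F.fullGradient_spec k q w (Roly_le_VPoly _ hw')]
  rfl

theorem vl2_discreteGradient_of_mem_RolyPerp (k : ℕ) (q : F.XGrad k) {w : VPoly2}
    (hw : w ∈ F.RolyPerp (k : ℤ)) :
    F.vl2 (F.discreteGradient k q).1 w = F.gradientForm k q w := by
  rw [discreteGradient_fst, map_add, LinearMap.add_apply, F.vl2_vproj _ _ hw,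
    F.vl2_eq_zero_of_mem (Roly_mono (by omega) (F.vproj (Roly ((k : ℤ) - 1)) _).2) hw, zero_add,
    F.fullGradient_spec k q w hw.1]
  rfl

/-- The discrete gradient is characterised by its products with `R_{k-1}(F)` and `R_k(F)^⊥`, in
which the full gradient may replace its projections since these two spaces are orthogonal. -/
theorem discreteGradient_eq_iff (k : ℕ) (q : F.XGrad k) (v : F.XRot k) :
    F.discreteGradient k q = v ↔ F.bdryGradient k q.2 = v.2 ∧
      (∀ w ∈ Roly ((k : ℤ) - 1), F.gradientForm k q w = F.vl2 v.1 w) ∧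
      ∀ w ∈ F.RolyPerp (k : ℤ), F.gradientForm k q w = F.vl2 v.1 w := by
  constructor
  · rintro rfl
    exact ⟨rfl, fun w hw => (F.vl2_discreteGradient_of_mem_Roly k q hw).symm,
      fun w hw => (F.vl2_discreteGradient_of_mem_RolyPerp k q hw).symm⟩
  · rintro ⟨h1, h2, h3⟩
    refine Prod.ext (Subtype.ext (sub_eq_zero.1 (F.vl2_definite _ ?_))) h1
    have hmem := sub_mem (F.discreteGradient k q).1.2 v.1.2
    obtain ⟨a, ha, b, hb, hab⟩ := Submodule.mem_sup.1 hmem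
    have hz : ∀ w, F.vl2 (F.discreteGradient k q).1 w = F.vl2 v.1 w →
        F.vl2 ((F.discreteGradient k q).1 - v.1 : VPoly2) w = 0 := fun w h => by
      rw [map_sub, LinearMap.sub_apply, h, sub_self]
    refine (congrArg (F.vl2 _) hab).symm.trans ?_
    rw [map_add, hz a ((F.vl2_discreteGradient_of_mem_Roly k q ha).trans (h2 a ha)),
      hz b ((F.vl2_discreteGradient_of_mem_RolyPerp k q hb).trans (h3 b hb)), add_zero]

theorem bdryGradient_apply (k : ℕ) (q : F.BdryPolyC ((k : ℤ) + 1)) (E : F.edges) :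
    (F.bdryGradient k q E : Polynomial ℝ) =
      Polynomial.derivative (F.restrictEdges _ q E : Polynomial ℝ) := rfl

/-- Integration by parts along the boundary, which is a cycle. -/
theorem sum_omega_mul_normalTrace_vrot (k : ℕ) (q : F.BdryPolyC ((k : ℤ) + 1)) (r : Poly2) :
    ∑ E : F.edges, F.omega E *
        edgeInt E ((F.restrictEdges _ q E : Polynomial ℝ) * normalTrace E (vrot r)) =
      ∑ E : F.edges, F.omega E *
        edgeInt E ((F.bdryGradient k q E : Polynomial ℝ) * edgeTrace E r) := by
  classical
  let f : Plane → ℝ := fun x =>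
    if h : x ∈ frontier F.carrier then
      (q : C(frontier F.carrier, ℝ)) ⟨x, h⟩ * MvPolynomial.eval (fun i => x i) r else 0
  have hf : ∀ (E : F.edges) (s : ℝ), s ∈ Set.Icc 0 (edgeLength E) →
      ((F.restrictEdges _ q E : Polynomial ℝ) * edgeTrace E r).eval s = f (edgePoint E s) := by
    intro E s hs
    rw [Polynomial.eval_mul, F.eval_restrictEdges _ _ E hs, eval_edgeTrace]
    simp only [f]
    rw [dif_pos (F.edgePoint_mem_frontier E.2 hs)]
  rw [← sub_eq_zero, ← Finset.sum_sub_distrib, ← neg_eq_zero, ← Finset.sum_neg_distrib,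
    ← F.sum_omega_mul_sub f]
  refine Finset.sum_congr rfl fun E _ => ?_
  have hL := (F.edgeLength_pos E.2).le
  rw [normalTrace_vrot, mul_neg, map_neg, edgeInt_mul_derivative, hf E _ ⟨hL, le_rfl⟩,
    hf E _ ⟨le_rfl, hL⟩, F.edgePoint_edgeLength E.2, edgePoint_zero, bdryGradient_apply]
  ring

theorem gradientForm_vrot (k : ℕ) (q : F.XGrad k) (r : Poly2) :
    F.gradientForm k q (vrot r) = ∑ E : F.edges, F.omega E *
      edgeInt E ((F.bdryGradient k q.2 E : Polynomial ℝ) * edgeTrace E r) := by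
  rw [gradientForm, divergence_vrot, mul_zero, map_zero, neg_zero, zero_add,
    sum_omega_mul_normalTrace_vrot]

theorem discreteCurl_eq_zero_iff (k : ℕ) (v : F.XRot k) :
    F.discreteCurl k v = 0 ↔ ∀ r ∈ Poly (k : ℤ), F.vl2 v.1 (vrot r) =
      ∑ E : F.edges, F.omega E * edgeInt E ((v.2 E : Polynomial ℝ) * edgeTrace E r) := by
  constructor
  · intro h r hr
    rw [← sub_eq_zero, ← F.discreteCurl_spec k v r hr, h]
    simp
  · intro h
    refine Subtype.ext (F.l2_definite _ ?_)
    rw [F.discreteCurl_spec k v _ (F.discreteCurl k v).2, h _ (F.discreteCurl k v).2, sub_self]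

theorem mem_Roly_sub_one {k : ℕ} {w : VPoly2} :
    w ∈ Roly ((k : ℤ) - 1) ↔ ∃ r ∈ Poly (k : ℤ), vrot r = w := by
  rw [Roly, sub_add_cancel]
  rfl

/-! ### Exactness -/

theorem isInterpolate_interpolator (k : ℕ) (q : Plane → ℝ)
    (hq : ContinuousOn q (closure F.carrier)) : F.IsInterpolate k q (F.interpolator k q hq) :=
  (F.existsUnique_interpolate k q hq).choose_spec.1

/-- The interpolate of a constant `a` is the projection of `a` in `F` and `a` itself on the
boundary. -/
theorem isInterpolate_const_iff (k : ℕ) (a : ℝ) (q : F.XGrad k) :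
    F.IsInterpolate k (fun _ => a) q ↔
      (∀ r ∈ Poly ((k : ℤ) - 1), F.faceInt (q.1 * r) = a * F.faceInt r) ∧
        ∀ E, (F.restrictEdges _ q.2 E : Polynomial ℝ) = Polynomial.C a := by
  have hface : ∀ r : Poly2, ∫ x in F.carrier,
      (MvPolynomial.eval (fun i => x i) (q.1 : Poly2) - a) * MvPolynomial.eval (fun i => x i) r =
        F.faceInt (q.1 * r) - a * F.faceInt r := fun r => by
    have h : F.faceInt (((q.1 : Poly2) - MvPolynomial.C a) * r) = ∫ x in F.carrier,
        MvPolynomial.eval (fun i => x i) (((q.1 : Poly2) - MvPolynomial.C a) * r) := rfl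
    rw [sub_mul, map_sub, MvPolynomial.C_mul', map_smul, smul_eq_mul] at h
    rw [h]
    simp
    congr 1
    funext x
    ring
  constructor
  · intro h
    refine ⟨fun r hr => sub_eq_zero.1 ((hface r).symm.trans (h.face r hr)), fun E => ?_⟩
    have hL := F.edgeLength_pos E.2
    refine sub_eq_zero.1 (edge_unique hL k _
      (sub_mem (F.restrictEdges _ q.2 E).2 (C_mem_edgePoly (by omega) a)) ?_ ?_ fun r hr => ?_)
    · rw [Polynomial.eval_sub, F.eval_restrictEdges _ _ E ⟨le_rfl, hL.le⟩,
        h.vertex E E.2 _ (Or.inl (edgePoint_zero _)), Polynomial.eval_C, sub_self]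
    · rw [Polynomial.eval_sub, F.eval_restrictEdges _ _ E ⟨hL.le, le_rfl⟩,
        h.vertex E E.2 _ (Or.inr (F.edgePoint_edgeLength E.2)), Polynomial.eval_C, sub_self]
    · refine Eq.trans ?_ (h.edge E r hr)
      change ∫ s in (0 : ℝ)..edgeLength E, _ = _
      simp
  · rintro ⟨h1, h2⟩
    refine ⟨fun r hr => by rw [hface, h1 r hr, sub_self], fun E r _ => by simp [h2 E], ?_⟩
    intro E hE x hx
    have hL := F.edgeLength_pos hE
    rcases hx with hx | hx
    · rw [F.restrictEdges_spec _ q.2 ⟨E, hE⟩ x 0 ⟨le_rfl, hL.le⟩ (by rw [hx, edgePoint_zero]), h2,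
        Polynomial.eval_C]
    · rw [F.restrictEdges_spec _ q.2 ⟨E, hE⟩ x _ ⟨hL.le, le_rfl⟩
        (by rw [hx, F.edgePoint_edgeLength hE]), h2, Polynomial.eval_C]

/-- If `q_{∂F}` is constant, the boundary term is the flux of a constant multiple of `w`, to which
the divergence theorem applies. -/
theorem gradientForm_of_const (k : ℕ) {a : ℝ} {q : F.XGrad k}
    (hq : ∀ E, (F.restrictEdges _ q.2 E : Polynomial ℝ) = Polynomial.C a) (w : VPoly2) :
    F.gradientForm k q w = -F.faceInt (q.1 * divergence w) + a * F.faceInt (divergence w) := by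
  rw [gradientForm, F.faceInt_divergence, Finset.mul_sum]
  congr 1
  refine Finset.sum_congr rfl fun E _ => ?_
  rw [hq, Polynomial.C_mul', map_smul, smul_eq_mul, mul_left_comm]

theorem exact_interpolator_discreteGradient (k : ℕ) :
    Function.Exact (fun c : ℝ => F.interpolator k (fun _ => c) continuousOn_const)
      (F.discreteGradient k) := by
  intro q
  rw [discreteGradient_eq_iff]
  constructor
  · rintro ⟨h1, -, h3⟩
    obtain ⟨a, ha⟩ := F.exists_eq_const_of_derivative_eq_zero q.2 fun E => by
      rw [← bdryGradient_apply, h1]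
      rfl
    have hq : ∀ E, (F.restrictEdges _ q.2 E : Polynomial ℝ) = Polynomial.C a := fun E =>
      IsEdgeRestriction.unique F E.2 (F.restrictEdges_spec _ q.2 E) fun x s _ _ => by
        rw [ha, Polynomial.eval_C]
    refine ⟨a, (F.existsUnique_interpolate k _ continuousOn_const).unique
      (F.isInterpolate_interpolator k _ continuousOn_const)
      ((F.isInterpolate_const_iff k a q).2 ⟨fun r hr => ?_, hq⟩)⟩
    obtain ⟨w, hw, rfl⟩ := F.exists_mem_RolyPerp hr
    have h := h3 w hw
    rw [F.gradientForm_of_const k hq] at h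
    simp only [Prod.fst_zero, ZeroMemClass.coe_zero, map_zero, LinearMap.zero_apply] at h
    linarith
  · rintro ⟨a, rfl⟩
    obtain ⟨h1, h2⟩ := (F.isInterpolate_const_iff k a _).1
      (F.isInterpolate_interpolator k _ continuousOn_const)
    have hw : ∀ w ∈ VPoly (k : ℤ),
        F.gradientForm k (F.interpolator k (fun _ => a) continuousOn_const) w =
          F.vl2 (0 : F.XRot k).1 w := fun w hw => by
      rw [F.gradientForm_of_const k h2, h1 _ (divergence_mem_Poly hw)]
      simp
    refine ⟨?_, fun w h => hw w (Roly_le_VPoly _ (Roly_mono (by omega) h)), fun w h => hw w h.1⟩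
    funext E
    refine Subtype.ext ?_
    rw [bdryGradient_apply, h2, Polynomial.derivative_C]
    rfl

/-- Polynomials on the edges are the tangential derivatives of a continuous function on the boundary
as soon as their total integral along the boundary is zero. -/
theorem exists_bdryGradient_eq (k : ℕ) (v : F.BdryPoly (k : ℤ))
    (hv : ∑ E : F.edges, F.omega E * edgeInt E (v E : Polynomial ℝ) = 0) :
    ∃ q, F.bdryGradient k q = v := by
  obtain ⟨f, hf⟩ := F.exists_potential hv
  choose p hp hp' hp0 using fun E : F.edges =>
    exists_edge_primitive (Int.natCast_nonneg k) (v E).2 (f (E : Plane × Plane).1)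
  obtain ⟨q, hq⟩ := F.exists_glue ((k : ℤ) + 1) f (fun E => ⟨p E, hp E⟩) hp0 fun E => by
    have h := edgeInt_derivative E (p E)
    rw [hp', hp0, ← hf E] at h
    change (p E).eval _ = _
    linarith
  refine ⟨q, funext fun E => Subtype.ext ?_⟩
  rw [bdryGradient_apply, IsEdgeRestriction.unique F E.2 (F.restrictEdges_spec _ q E) (hq E), hp']

theorem exact_discreteGradient_discreteCurl (k : ℕ) :
    Function.Exact (F.discreteGradient k) (F.discreteCurl k) := by
  intro v
  rw [discreteCurl_eq_zero_iff]
  constructor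
  · intro h
    obtain ⟨q, hq⟩ := F.exists_bdryGradient_eq k v.2 (by
      have h1 : (1 : Poly2) ∈ Poly (k : ℤ) := fun d hd => by
        rw [MvPolynomial.coeff_one, if_neg]
        rintro rfl
        simp at hd
        omega
      have h2 := h 1 h1
      have h3 : vrot 1 = 0 := by
        funext i
        fin_cases i
        · exact MvPolynomial.pderiv_one
        · change -MvPolynomial.pderiv 0 1 = 0
          rw [MvPolynomial.pderiv_one, neg_zero]
      rw [h3, map_zero] at h2
      simpa using h2.symm)
    -- the products with `R_k(F)^⊥` determine `q_F`, through the divergence.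
    let B : VPoly2 →ₗ[ℝ] ℝ := (∑ E : F.edges, F.omega E • (edgeInt E ∘ₗ
      LinearMap.mulLeft ℝ (F.restrictEdges _ q E : Polynomial ℝ) ∘ₗ normalTrace E)) - F.vl2 v.1
    let φ : Module.Dual ℝ (Poly ((k : ℤ) - 1)) :=
      B ∘ₗ (F.RolyPerp (k : ℤ)).subtype ∘ₗ (F.divergenceEquiv (k : ℤ)).symm.toLinearMap
    let qF := riesz F.l2 F.l2_definite (Poly ((k : ℤ) - 1)) φ
    have hqF : ∀ w ∈ F.RolyPerp (k : ℤ), F.faceInt (qF * divergence w) = B w := by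
      intro w hw
      have h1 := riesz_spec F.l2 F.l2_definite (Poly ((k : ℤ) - 1)) φ
        (F.divergenceEquiv (k : ℤ) ⟨w, hw⟩)
      have h2 : φ (F.divergenceEquiv (k : ℤ) ⟨w, hw⟩) = B w := by
        simp [φ]
      rw [h2] at h1
      exact h1
    refine ⟨(qF, q), (F.discreteGradient_eq_iff k _ v).2 ⟨hq, ?_, ?_⟩⟩
    · intro w hw
      obtain ⟨r, hr, rfl⟩ := mem_Roly_sub_one.1 hw
      rw [gradientForm_vrot, h r hr, hq]
    · intro w hw
      rw [gradientForm, hqF w hw]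
      simp [B]
  · rintro ⟨q, rfl⟩ r hr
    rw [F.vl2_discreteGradient_of_mem_Roly k q (mem_Roly_sub_one.2 ⟨r, hr, rfl⟩),
      gradientForm_vrot]
    rfl

theorem surjective_discreteCurl (k : ℕ) : Function.Surjective (F.discreteCurl k) := by
  rw [← LinearMap.range_eq_top]
  by_contra hne
  obtain ⟨ψ, hψ, hker⟩ := Submodule.exists_le_ker_of_lt_top _ (lt_top_iff_ne_top.2 hne)
  refine hψ ?_
  -- `r` represents a linear form that vanishes on the image
  let r := riesz F.l2 F.l2_definite (Poly (k : ℤ)) ψ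
  have hspec : ∀ p : Poly (k : ℤ), F.l2 r p = ψ p := riesz_spec F.l2 F.l2_definite _ ψ
  have hr : ∀ v : F.XRot k, F.vl2 v.1 (vrot r) =
      ∑ E : F.edges, F.omega E * edgeInt E ((v.2 E : Polynomial ℝ) * edgeTrace E r) := fun v => by
    rw [← sub_eq_zero, ← F.discreteCurl_spec k v r r.2, F.l2_comm, hspec]
    exact hker ⟨v, rfl⟩
  have hrot : vrot (r : Poly2) = 0 := by
    have hmem : vrot (r : Poly2) ∈ Roly ((k : ℤ) - 1) := mem_Roly_sub_one.2 ⟨r, r.2, rfl⟩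
    refine F.vl2_definite _ ((hr (⟨_, Submodule.mem_sup_left hmem⟩, 0)).trans ?_)
    simp
  obtain ⟨a, ha⟩ : ∃ a, (r : Poly2) = MvPolynomial.C a := ⟨_, eq_C_of_vrot_eq_zero hrot⟩
  have h0 := hr (0, fun E => ⟨Polynomial.C (F.omega E), C_mem_edgePoly (Int.natCast_nonneg k) _⟩)
  have hE : ∀ E : F.edges, F.omega E * edgeInt E (Polynomial.C (F.omega E) *
      edgeTrace E (r : Poly2)) = a * edgeLength E := fun E => by
    have h1 : edgeInt E (Polynomial.C a) = a * edgeLength E := by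
      simp [edgeInt, mul_comm]
    rw [Polynomial.C_mul', map_smul, smul_eq_mul, ← mul_assoc, F.omega_mul_self, one_mul, ← h1, ha]
    congr 1
    exact MvPolynomial.aeval_C _ _
  simp only [ZeroMemClass.coe_zero, map_zero, LinearMap.zero_apply, hE, ← Finset.mul_sum] at h0
  have hpos : 0 < ∑ E : F.edges, edgeLength E := by
    obtain ⟨E, hE⟩ := F.edges_nonempty
    exact Finset.sum_pos (fun E _ => F.edgeLength_pos E.2) ⟨⟨E, hE⟩, Finset.mem_univ _⟩
  have ha0 : a = 0 := (mul_eq_zero.1 h0.symm).resolve_right hpos.ne'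
  ext p
  rw [← hspec, ha, ha0, map_zero, map_zero]
  rfl

end OrientedPolygon

end DiscreteDeRham

end

theorem mainTheorem2 (F : DiscreteDeRham.OrientedPolygon) (k : ℕ) :
    Function.Exact (fun c : ℝ => F.interpolator k (fun _ => c) continuousOn_const)
        (F.discreteGradient k) ∧
      Function.Exact (F.discreteGradient k) (F.discreteCurl k) ∧
      Function.Surjective (F.discreteCurl k) :=
  ⟨F.exact_interpolator_discreteGradient k, F.exact_discreteGradient_discreteCurl k,
    F.surjective_discreteCurl k⟩
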